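/- Setting. Let $\Theta$ be a parameter set (with a $\sigma$-algebra) and $\eta:\Theta\times\mathbb{R}^d\to[0,1]$ a reward function, measurable in $\theta$ and twice continuously differentiable in $a$, such that for all $\theta,a,a_1,a_2$: $\|\nabla_a\eta(\theta,a)\|_2\le\zeta_g$, $\|\nabla_a^2\eta(\theta,a)\|_{\mathrm{sp}}\le\zeta_h$ and $\|\nabla^2_a\eta(\theta,a_1)-\nabla^2_a\eta(\theta,a_2)\|_{\mathrm{sp}}\le\zeta_{3rd}\|a_1-a_2\|_2$, where $\zeta_g,\zeta_h,\zeta_{3rd}>0$. The true parameter is $\theta^\star\in\Theta$. A point $a$ is an $(\epsilon_g,\epsilon_h)$-approximate local maximum of $f$ if $\|\nabla f(a)\|_2\le\epsilon_g$ and $\lambda_{\max}(\nabla^2 f(a))\le\epsilon_h$. Loss. For $x=(\bar x,\xi)$ with $\bar x=(a,a')$, $\xi=(u,v)$, let $\hat y_\theta(x)=[\eta(\theta,a),\ \eta(\theta,a'),\ \langle\nabla_a\eta(\theta,a'),u\rangle,\ \langle\nabla_a^2\eta(\theta,a')u,v\rangle]\in\mathbb{R}^4$. With $\kappa_1=2\zeta_g$,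 $\kappa_2=640\sqrt2\,\zeta_h$ and labels $y\in\mathcal{Y}=[0,1]^2\times\mathbb{R}^2$, put $$\ell((x,y);\theta)=(\hat y_1-y_1)^2+(\hat y_2-y_2)^2+\min(\kappa_1^2,(\hat y_3-y_3)^2)+\min(\kappa_2^2,(\hat y_4-y_4)^2),\qquad \hat y=\hat y_\theta(x).$$ Let $q$ be the law of $\xi=(u,v)$ for independent $u,v\sim\mathcal N(0,I_d)$. Sequential Rademacher complexity. $\mathfrak{R}_T=\sup_{\mathbf x,\mathbf y}\mathbb{E}_{\xi_1,\dots,\xi_T\sim q}\,\mathbb{E}_{\sigma}\big[\sup_{\theta\in\Theta}\sum_{t=1}^T\sigma_t\,\ell\big(((\mathbf x_t(\sigma),\xi_t),\mathbf y_t(\sigma));\theta\big)\big]$, where $\sigma$ is uniform on $\{\pm1\}^T$ and the outer supremum is over all trees $\mathbf x_t:\{\pm1\}^{t-1}\to\mathbb{R}^d\times\mathbb{R}^d$ and $\mathbf y_t:\{\pm1\}^{t-1}\to\mathcal Y$ ($1\le t\le T$), with $\mathbf x_t(\sigma)=\mathbf x_t(\sigma_1,\dots,\sigma_{t-1})$ and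 likewise for $\mathbf y_t$. Online learner. An online learner $\mathcal R$ maps each finite history $(x_i,y_i)_{i<t}$ to a probability distribution $p_t$ on $\Theta$. In round $t$ an adversary, who sees $p_t$, picks $\bar x_t$; then $\xi_t\sim q$ is drawn, $x_t=(\bar x_t,\xi_t)$, and the adversary picks $y_t\in\mathcal Y$. Let $\mathcal R$ be an online learner whose expected regret $\mathbb{E}_{\xi_t\sim q,\,\theta_t\sim p_t}\big[\sum_{t\le T}\ell((x_t,y_t);\theta_t)-\inf_\theta\sum_{t\le T}\ell((x_t,y_t);\theta)\big]$ is at most $2\mathfrak{R}_T$ against every adversary. (Expectations of suprema or infima over $\Theta$ that are not measurable are outer expectations.) Algorithm (ViOlin, with learner $\mathcal R$). Choose $a_0\in\mathbb{R}^d$ arbitrarily. For $t=1,2,\dots$: let $p_t=\mathcal R((x_i,y_i)_{i<t})$; let $a_t\in\arg\max_a\mathbb{E}_{\theta\sim p_t}[\eta(\theta,a)]$ (ties broken by any measurable function of the history; it is assumed that the maxima are attained); draw $\xi_t=(u_t,v_t)\sim q$ independently; set $x_t=((a_t,a_{t-1}),\xi_t)$, $y_t=\hat y_{\theta^\star}(x_t)$.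 Theorem. For all $\zeta_g,\zeta_h,\zeta_{3rd}>0$, $C_0\ge0$ and $k_0\in\mathbb{N}$ there are $C>0$ and $k\in\mathbb{N}$, depending on these five numbers only, such that the following holds in every setting as above (any $d$, $\Theta$, $\eta$, $\theta^\star$, $\mathcal R$, $a_0$). Let $T\in\mathbb{N}$ and $R\ge1$ satisfy $$\mathfrak{R}_T\le\sqrt{R\,T\,C_0(1+\log T)^{k_0}},$$ let $\epsilon>0$, and suppose that $$T\ge C\,R\,\epsilon^{-8}\big(1+\log(1+R)+\log(1+1/\epsilon)\big)^{k}.$$ Then, if the algorithm is run for $T$ steps, there exists $t\in\{1,\dots,T\}$ such that, with probability at least $1/2$, $a_t$ is an $(\epsilon,6\sqrt{\zeta_{3rd}\,\epsilon})$-approximate local maximum of $\eta(\theta^\star,\cdot)$. -/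

import Mathlib

open MeasureTheory ProbabilityTheory

noncomputable section

namespace ViOlin

/-! ### Online learning with stochastic input components -/

/-- Outer expectation `E*[f]`: the least expectation of an integrable majorant of `f`. For an
integrable `f` this is the usual expectation; it is needed because suprema and infima over an
arbitrary parameter set need not be measurable. -/
def outerExp {Ω : Type*} [MeasurableSpace Ω] (μ : Measure Ω) (f : Ω → ℝ) : ℝ :=
  sInf {r : ℝ | ∃ g : Ω → ℝ, Integrable g μ ∧ (∀ ω, f ω ≤ g ω) ∧ r = ∫ ω, g ω ∂μ}

/-- The first `s` entries of a sequence of length `T ≥ s`. -/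
def prefixOf {α : Type*} {T s : ℕ} (h : s ≤ T) (z : Fin T → α) : Fin s → α :=
  fun i => z (Fin.castLE h i)

/-- A `Z`-valued tree of depth `T`: the node of round `t` is a function of the `t` signs that come
before it (rounds are numbered from `0`). -/
abbrev Tree (T : ℕ) (Z : Type*) : Type _ := (t : Fin T) → (Fin t → ℤˣ) → Z

section OnlineLearning

variable {Xb Ξ Y : Type*} {Θ : Type*} [MeasurableSpace Xb] [MeasurableSpace Ξ] [MeasurableSpace Y]
  [MeasurableSpace Θ]

/-- The distribution-dependent sequential Rademacher complexity with horizon `T` of the class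
`{ℓ(·; θ) : θ ∈ Θ}`. The random parts `ξ₁, …, ξ_T` of the inputs are i.i.d. with law `q`, the signs
are uniform on `{±1}^T`, and the supremum is over all `Xb`-valued trees and all trees of labels with
values in the label set `L`. -/
def seqRademacher (q : Measure Ξ) (L : Set Y) (ℓ : (Xb × Ξ) × Y → Θ → ℝ) (T : ℕ) : ℝ :=
  ⨆ xy : Tree T Xb × Tree T L,
    outerExp (Measure.pi fun _ : Fin T => q) fun ξ =>
      (∑ σ : Fin T → ℤˣ,
        ⨆ θ : Θ, ∑ t : Fin T, ((σ t : ℤ) : ℝ) *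
          ℓ ((xy.1 t (prefixOf t.isLt.le σ), ξ t), (xy.2 t (prefixOf t.isLt.le σ) : Y)) θ)
        / 2 ^ T

/-- An online learner: it maps the data `(x₁, y₁), …, (x_s, y_s)` of the first `s` rounds
to a distribution over the parameter space (measurably in the data). -/
abbrev Learner (Xb Ξ Y Θ : Type*) [MeasurableSpace Xb] [MeasurableSpace Ξ] [MeasurableSpace Y]
    [MeasurableSpace Θ] : Type _ :=
  (s : ℕ) → Kernel (Fin s → (Xb × Ξ) × Y) Θ

/-- The data point of round `t` when the adversary plays `x̄_t = x t (ξ_0, …, ξ_{t-1})` and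
`y_t = y t (ξ_0, …, ξ_t)`. -/
def dataPoint {T : ℕ} (x : (t : Fin T) → (Fin t → Ξ) → Xb)
    (y : (t : Fin T) → (Fin (t + 1) → Ξ) → Y) (ξ : Fin T → Ξ) (t : Fin T) : (Xb × Ξ) × Y :=
  ((x t (prefixOf t.isLt.le ξ), ξ t), y t (prefixOf t.isLt ξ))

/-- The expected regret of the learner `A` in `T` rounds,
`E[∑ₜ ℓ((xₜ, yₜ); θₜ) - inf_θ ∑ₜ ℓ((xₜ, yₜ); θ)]` with `θₜ ∼ pₜ = A (history)` and `ξₜ ∼ q`.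
The adversary picks `x̄ₜ` before and `yₜ` after `ξₜ` is drawn; everything it has seen (including
`pₜ`) is determined by the `ξ`'s drawn so far, so its strategy is a function of these. -/
def onlineRegret (q : Measure Ξ) (ℓ : (Xb × Ξ) × Y → Θ → ℝ) (A : Learner Xb Ξ Y Θ) (T : ℕ)
    (x : (t : Fin T) → (Fin t → Ξ) → Xb) (y : (t : Fin T) → (Fin (t + 1) → Ξ) → Y) : ℝ :=
  outerExp (Measure.pi fun _ : Fin T => q) fun ξ =>
    (∑ t : Fin T, ∫ θ, ℓ (dataPoint x y ξ t) θ ∂(A t (prefixOf t.isLt.le (dataPoint x y ξ))))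
      - ⨅ θ : Θ, ∑ t : Fin T, ℓ (dataPoint x y ξ t) θ

/-- The guarantee of the online learner: against every adversary with labels in `L`, its regret in
`T` rounds is at most twice the sequential Rademacher complexity of the loss class. -/
def HasRademacherRegret (q : Measure Ξ) (L : Set Y) (ℓ : (Xb × Ξ) × Y → Θ → ℝ)
    (A : Learner Xb Ξ Y Θ) (T : ℕ) : Prop :=
  ∀ (x : (t : Fin T) → (Fin t → Ξ) → Xb) (y : (t : Fin T) → (Fin (t + 1) → Ξ) → Y),
    (∀ t, Measurable (x t)) → (∀ t, Measurable (y t)) → (∀ t ξ, y t ξ ∈ L) →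
      onlineRegret q ℓ A T x y ≤ 2 * seqRademacher q L ℓ T

end OnlineLearning

/-! ### The nonlinear bandit problem -/

/-- The action space. -/
abbrev Act (d : ℕ) : Type := EuclideanSpace ℝ (Fin d)

/-- The Hessian of `f` at `a`, as a linear operator; its operator norm is the spectral norm. -/
def hess {d : ℕ} (f : Act d → ℝ) (a : Act d) : Act d →L[ℝ] Act d := fderiv ℝ (gradient f) a

/-- `a` is an `(εg, εh)`-approximate local maximum of `f`: the gradient has norm at most `εg`,
and the largest eigenvalue of the Hessian is at most `εh`. -/
def IsApproxLocalMax {d : ℕ} (f : Act d → ℝ) (εg εh : ℝ) (a : Act d) : Prop :=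
  ‖gradient f a‖ ≤ εg ∧
    ∀ lam : ℝ, Module.End.HasEigenvalue (hess f a : Act d →ₗ[ℝ] Act d) lam → lam ≤ εh

/-- A reward function with values in `[0,1]`, twice continuously differentiable in the action, whose
gradient and Hessian are bounded by `ζg` and `ζh` and whose Hessian is `ζ₃`-Lipschitz. -/
structure RegularReward {d : ℕ} {Θ : Type*} (η : Θ → Act d → ℝ) (ζg ζh ζ₃ : ℝ) : Prop where
  mem_Icc : ∀ θ a, η θ a ∈ Set.Icc (0 : ℝ) 1
  contDiff : ∀ θ, ContDiff ℝ 2 (η θ)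
  norm_gradient_le : ∀ θ a, ‖gradient (η θ) a‖ ≤ ζg
  norm_hess_le : ∀ θ a, ‖hess (η θ) a‖ ≤ ζh
  norm_hess_sub_le : ∀ θ a₁ a₂, ‖hess (η θ) a₁ - hess (η θ) a₂‖ ≤ ζ₃ * ‖a₁ - a₂‖

/-- The inputs `x = ((a, a'), (u, v))` of the prediction task. -/
abbrev Input (d : ℕ) : Type := (Act d × Act d) × (Act d × Act d)

/-- The law of `ξ = (u, v)`: two independent standard Gaussian vectors. -/
def noise (d : ℕ) : Measure (Act d × Act d) := (stdGaussian (Act d)).prod (stdGaussian (Act d))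

/-- The vector `[η(θ,a), η(θ,a'), ⟨∇η(θ,a'), u⟩, ⟨∇²η(θ,a') u, v⟩]`: the prediction of the model `θ`,
and the supervision if `θ` is the true parameter. -/
def response {d : ℕ} {Θ : Type*} (η : Θ → Act d → ℝ) (θ : Θ) (x : Input d) : Fin 4 → ℝ :=
  ![η θ x.1.1, η θ x.1.2, inner ℝ (gradient (η θ) x.1.2) x.2.1,
    inner ℝ (hess (η θ) x.1.2 x.2.1) x.2.2]

/-- The label space `[0,1]² × ℝ² ⊆ ℝ⁴`: the first two labels are rewards. -/
def labelSet : Set (Fin 4 → ℝ) := {y | y 0 ∈ Set.Icc (0 : ℝ) 1 ∧ y 1 ∈ Set.Icc (0 : ℝ) 1}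

/-- The bandit loss `ℓ((x, y); θ)` with clipping levels `κ₁ = 2 ζg` and `κ₂ = 640 √2 ζh`. -/
def banditLoss {d : ℕ} {Θ : Type*} (ζg ζh : ℝ) (η : Θ → Act d → ℝ)
    (z : Input d × (Fin 4 → ℝ)) (θ : Θ) : ℝ :=
  (response η θ z.1 0 - z.2 0) ^ 2 + (response η θ z.1 1 - z.2 1) ^ 2
    + min ((2 * ζg) ^ 2) ((response η θ z.1 2 - z.2 2) ^ 2)
    + min ((640 * √2 * ζh) ^ 2) ((response η θ z.1 3 - z.2 3) ^ 2)

/-- An online learner for the bandit prediction task. -/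
abbrev BanditLearner (d : ℕ) (Θ : Type*) [MeasurableSpace Θ] : Type _ :=
  Learner (Act d × Act d) (Act d × Act d) (Fin 4 → ℝ) Θ

/-- A rule that picks the next action from the history (the first action `a₀` being fixed). -/
abbrev ActionRule (d : ℕ) : Type := (s : ℕ) → (Fin s → Input d × (Fin 4 → ℝ)) → Act d

/-- `s` rounds of the algorithm ViOlin with true parameter `θstar`, initial action `a₀` and Gaussian
samples `ξ`. The result is the current action `a_s` and the history of the `s` data points. In each
round the next action `a_{s+1}` is picked by `sel` from the history, the sample `(u, v)` is drawn and
the data point `x = ((a_{s+1}, a_s), (u, v))`, `y = response η θstar x` is appended. -/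
def violin {d : ℕ} {Θ : Type*} (η : Θ → Act d → ℝ) (θstar : Θ) (a₀ : Act d) (sel : ActionRule d) :
    (s : ℕ) → (Fin s → Act d × Act d) → Act d × (Fin s → Input d × (Fin 4 → ℝ))
  | 0, _ => (a₀, Fin.elim0)
  | s + 1, ξ =>
    let prev := violin η θstar a₀ sel s (Fin.init ξ)
    let a := sel s prev.2
    let x : Input d := ((a, prev.1), ξ (Fin.last s))
    (a, Fin.snoc prev.2 (x, response η θstar x))

/-- `sel` is a greedy rule for the first `T` rounds of the algorithm with learner `A`: with
`p_{s+1} = A (history of the first s rounds)`, the next action maximizes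
`a ↦ E_{θ ∼ p_{s+1}} [η(θ, a)]`, ties being broken arbitrarily (measurably in the history). -/
def IsGreedyRule {d : ℕ} {Θ : Type*} [MeasurableSpace Θ] (η : Θ → Act d → ℝ) (θstar : Θ)
    (a₀ : Act d) (A : BanditLearner d Θ) (T : ℕ) (sel : ActionRule d) : Prop :=
  (∀ s, Measurable (sel s)) ∧
    ∀ s < T, ∀ ξ : Fin s → Act d × Act d,
      IsMaxOn (fun a => ∫ θ, η θ a ∂(A s (violin η θstar a₀ sel s ξ).2)) Set.univ
        (sel s (violin η θstar a₀ sel s ξ).2)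

/-- The probability, over the Gaussian samples of `T` rounds, that the action `a_t` (`t ≤ T`) of the
algorithm satisfies `P`. -/
def actionProb {d : ℕ} {Θ : Type*} (η : Θ → Act d → ℝ) (θstar : Θ) (a₀ : Act d)
    (sel : ActionRule d) {T t : ℕ} (h : t ≤ T) (P : Act d → Prop) : ℝ :=
  (Measure.pi fun _ : Fin T => noise d).real
    {ξ | P (violin η θstar a₀ sel t (prefixOf h ξ)).1}

end ViOlin

end

noncomputable section

namespace ViOlin

/-! The labels are noiseless, so `θstar` has zero loss and the best loss in hindsight is zero. The
regret guarantee therefore bounds the learner's expected cumulative loss itself by twice the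
sequential Rademacher complexity (`integral_sum_learnerLoss_le`).

Up to a universal factor, the expected loss of a model in one round dominates its squared errors in
the reward at both actions and in the gradient and the Hessian along any one fixed direction
(`le_integral_roundLoss`). Gaussian probes make this factor dimension-free.

If the old action `a'` is not an approximate local maximum, a gradient or eigenvector step leads to
a point `b`, independent of the model, where every model gains `ω = c ε²` up to its derivative
errors along the step (`exists_improvement`). The greedy action beats `b` on average over the
learner's distribution. By AM-GM, passing to the true reward costs at most `ω / 4` plus a multiple
of the expected loss over `ω` (`reward_sub_ge`).

Summed over the rounds, the true rewards telescope to at most one (`progress_sum`). If every action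
after the initial one were good with probability below `1/2`, then `ω T` would be bounded by a
constant plus a multiple of the complexity over `ω`. As the complexity is at most of order `√(R T)`
up to logarithms, this contradicts `T` being large compared with `R / ω⁴`, that is, `R ε⁻⁸` up to
logarithms. -/

/-! ### Lower bounds for clipped Gaussian moments -/

/-- The truncated second moment of a standard normal variable. -/
def truncMoment : ℝ := ∫ x, min 1 (x ^ 2) ∂(gaussianReal 0 1)

lemma integrable_of_measurable_of_mem_Icc {α : Type*} [MeasurableSpace α] {μ : Measure α}
    [IsFiniteMeasure μ] {f : α → ℝ} (hf : Measurable f) {a b : ℝ}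
    (h : ∀ x, f x ∈ Set.Icc a b) : Integrable f μ :=
  Integrable.of_mem_Icc a b hf.aemeasurable (Filter.Eventually.of_forall h)

lemma truncMoment_pos : 0 < truncMoment := by
  have hint : Integrable (fun x : ℝ => min 1 (x ^ 2)) (gaussianReal 0 1) :=
    integrable_of_measurable_of_mem_Icc (a := 0) (b := 1) (by fun_prop)
      fun x => ⟨by positivity, min_le_left _ _⟩
  have := nullSingletonClass_gaussianReal (μ := 0) (v := 1) one_ne_zero
  rw [truncMoment, integral_pos_iff_support_of_nonneg (fun x => by positivity) hint]
  have hs : Function.support (fun x : ℝ => min 1 (x ^ 2)) = {0}ᶜ := by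
    ext x
    simp only [Function.mem_support, Set.mem_compl_iff, Set.mem_singleton_iff]
    constructor
    · rintro h rfl
      simp at h
    · intro h
      have : 0 < min 1 (x ^ 2) := by positivity
      exact this.ne'
  rw [hs, measure_compl (measurableSet_singleton 0) (measure_ne_top _ _)]
  simp

lemma truncMoment_le_one : truncMoment ≤ 1 := by
  have hint : Integrable (fun x : ℝ => min 1 (x ^ 2)) (gaussianReal 0 1) :=
    integrable_of_measurable_of_mem_Icc (a := 0) (b := 1) (by fun_prop)
      fun x => ⟨by positivity, min_le_left _ _⟩
  calc truncMoment ≤ ∫ _, (1 : ℝ) ∂(gaussianReal 0 1) :=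
        integral_mono hint (integrable_const _) fun x => min_le_left _ _
    _ = 1 := by simp

lemma map_inner_stdGaussian {d : ℕ} (w : Act d) :
    (stdGaussian (Act d)).map (fun u => inner ℝ w u) =
      (gaussianReal 0 1).map (fun x => ‖w‖ * x) := by
  have h := IsGaussian.map_eq_gaussianReal (μ := stdGaussian (Act d)) (innerSL ℝ w)
  rw [integral_strongDual_stdGaussian, variance_dual_stdGaussian] at h
  rw [gaussianReal_map_const_mul]
  have hw : ‖innerSL ℝ w‖ = ‖w‖ := innerSL_apply_norm ℝ w
  rw [hw] at h
  convert h using 2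
  · simp
  · exact mul_zero _
  · rw [mul_one, Real.toNNReal_of_nonneg (sq_nonneg _)]

/-- Separates the clipped Gaussian factor from the clipped size of the vector, so that one constant,
`truncMoment`, serves every clipping level `K`. -/
lemma min_mul_min_le {K s x : ℝ} (hK : 0 ≤ K) (hs : 0 ≤ s) (hx : 0 ≤ x) :
    min 1 x * min K s ≤ min K (s * x) := by
  rcases le_total 1 x with h | h
  · rw [min_eq_left h, one_mul]
    exact min_le_min le_rfl (le_mul_of_one_le_right hs h)
  · rw [min_eq_right h]
    refine le_min ?_ ?_
    · exact (mul_le_of_le_one_left (le_min hK hs) h).trans (min_le_left _ _)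
    · rw [mul_comm s]
      exact mul_le_mul_of_nonneg_left (min_le_right _ _) hx

/-- The projection of a standard Gaussian vector on `w` has the law of `‖w‖` times a scalar standard
normal, so neither the dimension nor `K` enters the constant. -/
lemma truncMoment_mul_le_integral_inner {d : ℕ} {K : ℝ} (hK : 0 ≤ K) (w : Act d) :
    truncMoment * min K (‖w‖ ^ 2) ≤ ∫ u, min K (inner ℝ w u ^ 2) ∂(stdGaussian (Act d)) := by
  have h1 : ∫ u, min K (inner ℝ w u ^ 2) ∂(stdGaussian (Act d)) =
      ∫ x, min K (‖w‖ ^ 2 * x ^ 2) ∂(gaussianReal 0 1) := by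
    have e1 := integral_map (μ := stdGaussian (Act d)) (φ := fun u => inner ℝ w u)
      (f := fun x : ℝ => min K (x ^ 2)) (by fun_prop)
      (by exact (Measurable.aestronglyMeasurable (by fun_prop)))
    have e2 := integral_map (μ := gaussianReal 0 1) (φ := fun x => ‖w‖ * x)
      (f := fun x : ℝ => min K (x ^ 2)) (by fun_prop)
      (by exact (Measurable.aestronglyMeasurable (by fun_prop)))
    rw [map_inner_stdGaussian, e2] at e1
    rw [← e1]
    simp only [mul_pow]
  rw [h1, truncMoment, ← integral_mul_const]
  refine integral_mono ?_ ?_ fun x => min_mul_min_le hK (sq_nonneg _) (sq_nonneg _)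
  · exact (integrable_of_measurable_of_mem_Icc (a := 0) (b := 1) (by fun_prop)
      fun x => ⟨by positivity, min_le_left _ _⟩).mul_const _
  · exact integrable_of_measurable_of_mem_Icc (a := 0) (b := K) (by fun_prop)
      fun x => ⟨le_min hK (by positivity), min_le_left _ _⟩

instance isProbabilityMeasure_noise (d : ℕ) : IsProbabilityMeasure (noise d) := by
  unfold noise; infer_instance

lemma truncMoment_mul_le_integral_noise_inner {d : ℕ} {K : ℝ} (hK : 0 ≤ K) (w : Act d) :
    truncMoment * min K (‖w‖ ^ 2) ≤ ∫ ξ, min K (inner ℝ w ξ.1 ^ 2) ∂(noise d) := by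
  refine (truncMoment_mul_le_integral_inner hK w).trans_eq ?_
  rw [noise, integral_fun_fst (fun u : Act d => min K (inner ℝ w u ^ 2))]
  simp

/-- The one-vector bound is used twice. Averaging over `v` leaves `‖H u‖`, which dominates the
pairing of `H u` with `e`, hence of `u` with the adjoint image of `e`. Averaging over `u` then
leaves the norm of that image. Symmetry of `H` is not needed. -/
lemma truncMoment_sq_mul_le_integral_noise {d : ℕ} {K : ℝ} (hK : 0 ≤ K)
    (H : Act d →L[ℝ] Act d) {e : Act d} (he : ‖e‖ ≤ 1) :
    truncMoment ^ 2 * min K (inner ℝ (H e) e ^ 2) ≤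
      ∫ ξ, min K (inner ℝ (H ξ.1) ξ.2 ^ 2) ∂(noise d) := by
  have hint : Integrable (fun ξ : Act d × Act d => min K (inner ℝ (H ξ.1) ξ.2 ^ 2)) (noise d) :=
    integrable_of_measurable_of_mem_Icc (a := 0) (b := K) (by fun_prop)
      fun x => ⟨le_min hK (by positivity), min_le_left _ _⟩
  rw [noise] at hint ⊢
  rw [integral_prod _ hint]
  have hpt : ∀ u : Act d, truncMoment * min K (inner ℝ (H.adjoint e) u ^ 2) ≤
      ∫ v, min K (inner ℝ (H u) v ^ 2) ∂(stdGaussian (Act d)) := by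
    intro u
    refine le_trans ?_ (truncMoment_mul_le_integral_inner hK (H u))
    refine mul_le_mul_of_nonneg_left (min_le_min le_rfl ?_) truncMoment_pos.le
    rw [ContinuousLinearMap.adjoint_inner_left]
    rw [sq_le_sq, abs_norm]
    refine (abs_real_inner_le_norm _ _).trans ?_
    exact mul_le_of_le_one_left (norm_nonneg _) he
  calc truncMoment ^ 2 * min K (inner ℝ (H e) e ^ 2)
      ≤ truncMoment * (truncMoment * min K (‖H.adjoint e‖ ^ 2)) := by
        rw [sq, mul_assoc]
        have := truncMoment_pos.le
        refine mul_le_mul_of_nonneg_left (mul_le_mul_of_nonneg_left (min_le_min le_rfl ?_) this) this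
        rw [sq_le_sq, abs_norm, ← ContinuousLinearMap.adjoint_inner_right]
        refine (abs_real_inner_le_norm _ _).trans ?_
        exact mul_le_of_le_one_left (norm_nonneg _) he
    _ ≤ truncMoment * ∫ u, min K (inner ℝ (H.adjoint e) u ^ 2) ∂(stdGaussian (Act d)) :=
        mul_le_mul_of_nonneg_left (truncMoment_mul_le_integral_inner hK _) truncMoment_pos.le
    _ = ∫ u, truncMoment * min K (inner ℝ (H.adjoint e) u ^ 2) ∂(stdGaussian (Act d)) :=
        (integral_const_mul _ _).symm
    _ ≤ _ := by
        refine integral_mono ?_ hint.integral_prod_left hpt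
        exact (integrable_of_measurable_of_mem_Icc (a := 0) (b := K) (by fun_prop)
          fun x => ⟨le_min hK (by positivity), min_le_left _ _⟩).const_mul _

/-! ### Taylor expansion along a ray -/

section Calculus

variable {d : ℕ} {f : Act d → ℝ}

lemma contDiff_gradient (hf : ContDiff ℝ 2 f) : ContDiff ℝ 1 (gradient f) := by
  have h : ContDiff ℝ 1 (fderiv ℝ f) := hf.fderiv_right (by norm_num)
  exact (InnerProductSpace.toDual ℝ (Act d)).symm.contDiff.comp h

lemma hasDerivAt_add_smul (a e : Act d) (s : ℝ) : HasDerivAt (fun r : ℝ => a + r • e) e s := by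
  simpa using ((hasDerivAt_id s).smul_const e).const_add a

lemma hasDerivAt_comp_line (hf : ContDiff ℝ 2 f) (a e : Act d) (s : ℝ) :
    HasDerivAt (fun r : ℝ => f (a + r • e)) (inner ℝ (gradient f (a + s • e)) e) s := by
  have h := ((hf.differentiable (by norm_num)) (a + s • e)).hasGradientAt.hasFDerivAt
  simpa [Function.comp_def] using h.comp_hasDerivAt s (hasDerivAt_add_smul a e s)

lemma hasDerivAt_inner_gradient_comp_line (hf : ContDiff ℝ 2 f) (a u v : Act d) (s : ℝ) :
    HasDerivAt (fun r : ℝ => inner ℝ (gradient f (a + r • u)) v)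
      (inner ℝ (hess f (a + s • u) u) v) s := by
  have h := (((contDiff_gradient hf).differentiable one_ne_zero) (a + s • u)).hasFDerivAt
  have h2 := h.comp_hasDerivAt s (hasDerivAt_add_smul a u s)
  simpa [hess, Function.comp_def] using h2.inner ℝ (hasDerivAt_const s v)

lemma le_of_hasDerivAt_nonneg {g g' : ℝ → ℝ} {s : ℝ} (hg : ∀ r, HasDerivAt g (g' r) r)
    (h : ∀ r ∈ Set.Icc 0 s, 0 ≤ g' r) : ∀ r ∈ Set.Icc 0 s, g 0 ≤ g r := by
  have hmono : MonotoneOn g (Set.Icc 0 s) := by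
    refine monotoneOn_of_deriv_nonneg (convex_Icc 0 s)
      (fun r _ => (hg r).continuousAt.continuousWithinAt)
      (fun r _ => (hg r).differentiableAt.differentiableWithinAt) fun r hr => ?_
    rw [(hg r).deriv]
    exact h r (interior_subset hr)
  intro r hr
  exact hmono ⟨le_rfl, hr.1.trans hr.2⟩ hr hr.1

/-- Second-order Taylor lower bound along a ray. -/
lemma taylor_lower_bound (hf : ContDiff ℝ 2 f) (a e : Act d) {s m : ℝ} (hs : 0 ≤ s)
    (hm : ∀ r ∈ Set.Icc 0 s, m ≤ inner ℝ (hess f (a + r • e) e) e) :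
    f a + s * inner ℝ (gradient f a) e + m * s ^ 2 / 2 ≤ f (a + s • e) := by
  -- The curvature bound is integrated twice by monotonicity: here it bounds the slope from below,
  -- and in `h2` the slope bounds the value.
  have h1 : ∀ r ∈ Set.Icc 0 s,
      inner ℝ (gradient f (a + (0 : ℝ) • e)) e - m * 0 ≤
        inner ℝ (gradient f (a + r • e)) e - m * r :=
    le_of_hasDerivAt_nonneg
      (g := fun r => inner ℝ (gradient f (a + r • e)) e - m * r)
      (g' := fun r => inner ℝ (hess f (a + r • e) e) e - m)
      (fun r => by
        simpa using (hasDerivAt_inner_gradient_comp_line hf a e e r).fun_sub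
          ((hasDerivAt_id r).const_mul m))
      (fun r hr => sub_nonneg.2 (hm r hr))
  have h2 := le_of_hasDerivAt_nonneg
      (g := fun r => f (a + r • e) - r * inner ℝ (gradient f a) e - m / 2 * r ^ 2)
      (g' := fun r => inner ℝ (gradient f (a + r • e)) e - inner ℝ (gradient f a) e - m * r)
      (s := s)
      (fun r => by
        refine (((hasDerivAt_comp_line hf a e r).fun_sub
          ((hasDerivAt_id r).mul_const (inner ℝ (gradient f a) e))).fun_sub
          ((hasDerivAt_pow 2 r).const_mul (m / 2))).congr_deriv ?_
        simp
        ring)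
      (fun r hr => by
        have := h1 r hr
        simp only [zero_smul, add_zero, mul_zero] at this
        linarith) s ⟨hs, le_rfl⟩
  simp only [zero_smul, add_zero] at h2
  linarith

end Calculus

/-! ### Joint measurability of rewards, derivatives and loss -/

section Measurability

variable {d : ℕ} {Θ : Type*} [MeasurableSpace Θ] {η : Θ → Act d → ℝ}

lemma tendsto_difference_quotient {g : ℝ → ℝ} {g' : ℝ} (h : HasDerivAt g g' 0) :
    Filter.Tendsto (fun n : ℕ => ((1 : ℝ) / (n + 1))⁻¹ * (g (1 / ((n : ℝ) + 1)) - g 0))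
      Filter.atTop (nhds g') := by
  have h1 : Filter.Tendsto (fun n : ℕ => (1 : ℝ) / (n + 1)) Filter.atTop (nhdsWithin 0 {0}ᶜ) := by
    refine tendsto_nhdsWithin_iff.2 ⟨tendsto_one_div_add_atTop_nhds_zero_nat, ?_⟩
    exact Filter.Eventually.of_forall fun n => by
      have : (0 : ℝ) < 1 / (n + 1) := by positivity
      exact this.ne'
  simpa [Function.comp_def] using h.tendsto_slope_zero.comp h1

lemma measurable_uncurry_reward (hη : ∀ θ, ContDiff ℝ 2 (η θ))
    (hm : ∀ a, Measurable fun θ => η θ a) : Measurable fun p : Θ × Act d => η p.1 p.2 :=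
  (measurable_uncurry_of_continuous_of_measurable (u := fun a θ => η θ a)
    (fun θ => (hη θ).continuous) hm).comp measurable_swap

/-- A directional derivative is the pointwise limit of difference quotients of the jointly
measurable reward. The Hessian form is treated in the same way, starting from the gradient pairing.
-/
lemma measurable_inner_gradient (hη : ∀ θ, ContDiff ℝ 2 (η θ))
    (hm : ∀ a, Measurable fun θ => η θ a) :
    Measurable fun p : Θ × (Act d × Act d) => inner ℝ (gradient (η p.1) p.2.1) p.2.2 := by
  have hjoint := measurable_uncurry_reward hη hm
  refine measurable_of_tendsto_metrizable (f := fun (n : ℕ) (p : Θ × (Act d × Act d)) =>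
    ((1 : ℝ) / (n + 1))⁻¹ * (η p.1 (p.2.1 + (1 / ((n : ℝ) + 1)) • p.2.2) -
      η p.1 (p.2.1 + (0 : ℝ) • p.2.2))) (fun n => ?_) ?_
  · have h1 : Measurable fun p : Θ × (Act d × Act d) =>
        η p.1 (p.2.1 + (1 / ((n : ℝ) + 1)) • p.2.2) :=
      hjoint.comp (by fun_prop : Measurable fun p : Θ × (Act d × Act d) =>
        (p.1, p.2.1 + (1 / ((n : ℝ) + 1)) • p.2.2))
    have h2 : Measurable fun p : Θ × (Act d × Act d) => η p.1 (p.2.1 + (0 : ℝ) • p.2.2) :=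
      hjoint.comp (by fun_prop : Measurable fun p : Θ × (Act d × Act d) =>
        (p.1, p.2.1 + (0 : ℝ) • p.2.2))
    exact (h1.sub h2).const_mul _
  · refine tendsto_pi_nhds.2 fun p => ?_
    have h := tendsto_difference_quotient (hasDerivAt_comp_line (hη p.1) p.2.1 p.2.2 0)
    simp only [zero_smul, add_zero] at h ⊢
    exact h

lemma measurable_inner_hess (hη : ∀ θ, ContDiff ℝ 2 (η θ))
    (hm : ∀ a, Measurable fun θ => η θ a) :
    Measurable fun p : Θ × (Act d × (Act d × Act d)) =>
      inner ℝ (hess (η p.1) p.2.1 p.2.2.1) p.2.2.2 := by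
  have hjoint := measurable_inner_gradient hη hm
  have hline : ∀ r : ℝ, Measurable fun p : Θ × (Act d × (Act d × Act d)) =>
      inner ℝ (gradient (η p.1) (p.2.1 + r • p.2.2.1)) p.2.2.2 := fun r => by
    have h : Measurable fun p : Θ × (Act d × (Act d × Act d)) =>
        ((p.1, p.2.1 + r • p.2.2.1, p.2.2.2) : Θ × (Act d × Act d)) := by fun_prop
    have h2 := hjoint.comp h
    simp only [Function.comp_def] at h2
    exact h2
  refine measurable_of_tendsto_metrizable (f := fun (n : ℕ) (p : Θ × (Act d × (Act d × Act d))) =>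
    ((1 : ℝ) / (n + 1))⁻¹ *
      (inner ℝ (gradient (η p.1) (p.2.1 + (1 / ((n : ℝ) + 1)) • p.2.2.1)) p.2.2.2 -
      inner ℝ (gradient (η p.1) (p.2.1 + (0 : ℝ) • p.2.2.1)) p.2.2.2))
    (fun n => ((hline _).sub (hline _)).const_mul _) ?_
  refine tendsto_pi_nhds.2 fun p => ?_
  have h := tendsto_difference_quotient
    (hasDerivAt_inner_gradient_comp_line (hη p.1) p.2.1 p.2.2.1 p.2.2.2 0)
  simp only [zero_smul, add_zero] at h ⊢
  exact h

lemma measurable_response (hη : ∀ θ, ContDiff ℝ 2 (η θ)) (hm : ∀ a, Measurable fun θ => η θ a) :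
    Measurable fun p : Θ × Input d => response η p.1 p.2 := by
  have h0 : Measurable fun p : Θ × Input d => η p.1 p.2.1.1 := by
    have h : Measurable fun p : Θ × Input d => (p.1, p.2.1.1) := by fun_prop
    have h2 := (measurable_uncurry_reward hη hm).comp h
    simp only [Function.comp_def] at h2
    exact h2
  have h1 : Measurable fun p : Θ × Input d => η p.1 p.2.1.2 := by
    have h : Measurable fun p : Θ × Input d => (p.1, p.2.1.2) := by fun_prop
    have h2 := (measurable_uncurry_reward hη hm).comp h
    simp only [Function.comp_def] at h2
    exact h2
  have h2 : Measurable fun p : Θ × Input d => inner ℝ (gradient (η p.1) p.2.1.2) p.2.2.1 := by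
    have h : Measurable fun p : Θ × Input d => (p.1, p.2.1.2, p.2.2.1) := by fun_prop
    have h2 := (measurable_inner_gradient hη hm).comp h
    simp only [Function.comp_def] at h2
    exact h2
  have h3 : Measurable fun p : Θ × Input d =>
      inner ℝ (hess (η p.1) p.2.1.2 p.2.2.1) p.2.2.2 := by
    have h : Measurable fun p : Θ × Input d => (p.1, p.2.1.2, p.2.2) := by fun_prop
    have h2 := (measurable_inner_hess hη hm).comp h
    simp only [Function.comp_def] at h2
    exact h2
  refine measurable_pi_iff.2 (Fin.forall_fin_succ.2 ⟨h0, Fin.forall_fin_succ.2 ⟨h1,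
    Fin.forall_fin_succ.2 ⟨h2, Fin.forall_fin_succ.2 ⟨h3, fun i => i.elim0⟩⟩⟩⟩)

lemma measurable_banditLoss (ζg ζh : ℝ) (hη : ∀ θ, ContDiff ℝ 2 (η θ))
    (hm : ∀ a, Measurable fun θ => η θ a) :
    Measurable fun p : (Input d × (Fin 4 → ℝ)) × Θ => banditLoss ζg ζh η p.1 p.2 := by
  have h : ∀ i, Measurable fun p : (Input d × (Fin 4 → ℝ)) × Θ => response η p.2 p.1.1 i :=
    fun i => (measurable_pi_apply i).comp ((measurable_response hη hm).comp
      (by fun_prop : Measurable fun p : (Input d × (Fin 4 → ℝ)) × Θ => (p.2, p.1.1)))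
  have h' : ∀ i, Measurable fun p : (Input d × (Fin 4 → ℝ)) × Θ => p.1.2 i := fun i => by fun_prop
  unfold banditLoss
  exact (((((h 0).sub (h' 0)).pow_const 2).add (((h 1).sub (h' 1)).pow_const 2)).add
    (measurable_const.min (((h 2).sub (h' 2)).pow_const 2))).add
    (measurable_const.min (((h 3).sub (h' 3)).pow_const 2))

lemma measurable_response_apply (hη : ∀ θ, ContDiff ℝ 2 (η θ))
    (hm : ∀ a, Measurable fun θ => η θ a) (θ : Θ) : Measurable (response η θ) :=
  (measurable_response hη hm).comp measurable_prodMk_left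

end Measurability

/-! ### Improving points common to all models -/

section Improvement

variable {d : ℕ} {Θ : Type*} {η : Θ → Act d → ℝ} {ζg ζh ζ₃ : ℝ}

lemma RegularReward.abs_inner_hess_le (h : RegularReward η ζg ζh ζ₃) (θ : Θ) (a : Act d)
    {e : Act d} (he : ‖e‖ ≤ 1) : |inner ℝ (hess (η θ) a e) e| ≤ ζh := by
  have h1 : ‖hess (η θ) a e‖ ≤ ‖hess (η θ) a‖ :=
    ((hess (η θ) a).le_opNorm e).trans (mul_le_of_le_one_right (norm_nonneg _) he)
  calc |inner ℝ (hess (η θ) a e) e| ≤ ‖hess (η θ) a e‖ * ‖e‖ := abs_real_inner_le_norm _ _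
    _ ≤ ‖hess (η θ) a e‖ := mul_le_of_le_one_right (norm_nonneg _) he
    _ ≤ ζh := h1.trans (h.norm_hess_le θ a)

/-- Gradient step: a first-order improvement of every model of the class. -/
lemma RegularReward.gradient_step (h : RegularReward η ζg ζh ζ₃) (θ : Θ) (a : Act d)
    {e : Act d} (he : ‖e‖ ≤ 1) {s : ℝ} (hs : 0 ≤ s) :
    η θ a + s * inner ℝ (gradient (η θ) a) e - ζh * s ^ 2 / 2 ≤ η θ (a + s • e) := by
  have := taylor_lower_bound (h.contDiff θ) a e hs (m := -ζh)
    fun r _ => (abs_le.1 (h.abs_inner_hess_le θ _ he)).1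
  linarith

/-- Curvature step: a second-order improvement of every model of the class. -/
lemma RegularReward.curvature_step (h : RegularReward η ζg ζh ζ₃) (hζ₃ : 0 < ζ₃) (θ : Θ)
    (a : Act d) {e : Act d} (he : ‖e‖ ≤ 1) {s : ℝ} (hs : 0 ≤ s) :
    η θ a + s * inner ℝ (gradient (η θ) a) e + s ^ 2 / 2 * inner ℝ (hess (η θ) a e) e
      - ζ₃ * s ^ 3 / 2 ≤ η θ (a + s • e) := by
  -- Along the segment the Hessian moves by at most `ζ₃ * s`; this loss of curvature becomes the
  -- remainder `ζ₃ * s ^ 3 / 2`.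
  have := taylor_lower_bound (h.contDiff θ) a e hs
    (m := inner ℝ (hess (η θ) a e) e - ζ₃ * s) fun r hr => by
      have h1 : |inner ℝ ((hess (η θ) a - hess (η θ) (a + r • e)) e) e| ≤ ζ₃ * s := by
        calc |inner ℝ ((hess (η θ) a - hess (η θ) (a + r • e)) e) e|
            ≤ ‖(hess (η θ) a - hess (η θ) (a + r • e)) e‖ * ‖e‖ := abs_real_inner_le_norm _ _
          _ ≤ ‖(hess (η θ) a - hess (η θ) (a + r • e)) e‖ :=
              mul_le_of_le_one_right (norm_nonneg _) he
          _ ≤ ‖hess (η θ) a - hess (η θ) (a + r • e)‖ :=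
              (ContinuousLinearMap.le_opNorm _ e).trans
                (mul_le_of_le_one_right (norm_nonneg _) he)
          _ ≤ ζ₃ * ‖a - (a + r • e)‖ := h.norm_hess_sub_le θ _ _
          _ ≤ ζ₃ * s := by
              refine mul_le_mul_of_nonneg_left ?_ hζ₃.le
              rw [sub_add_cancel_left, norm_neg, norm_smul, Real.norm_of_nonneg hr.1]
              exact (mul_le_of_le_one_right hr.1 he).trans hr.2
      rw [sub_apply, inner_sub_left] at h1
      linarith [(abs_le.1 h1).2]
  linarith

/-- If `a` is not an approximate local maximum of the true reward, some point improves on `a` by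
`c ε²` in every model, up to the model's error in one directional derivative of order one and two. -/
lemma RegularReward.exists_improvement (h : RegularReward η ζg ζh ζ₃) (hζh : 0 < ζh)
    (hζ₃ : 0 < ζ₃) (θstar : Θ) {a : Act d} {ε S c : ℝ} (hε : 0 < ε)
    (hS1 : ε / ζh ≤ S) (hS2 : √(ε / ζ₃) ≤ S) (hS3 : ε / ζ₃ ≤ S)
    (hc1 : c ≤ 1 / (2 * ζh)) (hc2 : c * (ζ₃ * S) ≤ 1)
    (hc0 : 0 ≤ c) (ha : ¬ IsApproxLocalMax (η θstar) ε (6 * √(ζ₃ * ε)) a) :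
    ∃ e : Act d, ‖e‖ ≤ 1 ∧ ∃ b : Act d, ∀ θ,
      η θ a + c * ε ^ 2 - S * |inner ℝ (gradient (η θ) a - gradient (η θstar) a) e|
        - S * |inner ℝ ((hess (η θ) a - hess (η θstar) a) e) e| ≤ η θ b := by
  have hS : 0 ≤ S := (div_pos hε hζh).le.trans hS1
  by_cases hg : ‖gradient (η θstar) a‖ ≤ ε
  · have hlam : ∃ lam : ℝ,
        Module.End.HasEigenvalue (hess (η θstar) a : Act d →ₗ[ℝ] Act d) lam ∧
          6 * √(ζ₃ * ε) < lam := by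
      by_contra hcon
      push Not at hcon
      exact ha ⟨hg, hcon⟩
    obtain ⟨lam, hlam, hlt⟩ := hlam
    obtain ⟨v, hv⟩ := hlam.exists_hasEigenvector
    have hHv : hess (η θstar) a v = lam • v := hv.apply_eq_smul
    have hv0 : 0 < ‖v‖ := norm_pos_iff.2 hv.2
    -- Replacing an eigenvector by its negative makes the first-order term nonnegative, so it can be
    -- dropped.
    obtain ⟨e, hen, hHe, hge⟩ : ∃ e : Act d, ‖e‖ = 1 ∧ hess (η θstar) a e = lam • e ∧
        0 ≤ inner ℝ (gradient (η θstar) a) e := by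
      have hn : ‖(‖v‖⁻¹ : ℝ) • v‖ = 1 := by
        rw [norm_smul, norm_inv, norm_norm, inv_mul_cancel₀ hv0.ne']
      have hH : hess (η θstar) a ((‖v‖⁻¹ : ℝ) • v) = lam • ((‖v‖⁻¹ : ℝ) • v) := by
        rw [map_smul, hHv, smul_comm]
      rcases le_total 0 (inner ℝ (gradient (η θstar) a) ((‖v‖⁻¹ : ℝ) • v)) with h0 | h0
      · exact ⟨_, hn, hH, h0⟩
      · refine ⟨-((‖v‖⁻¹ : ℝ) • v), by rw [norm_neg, hn], by rw [map_neg, hH, smul_neg], ?_⟩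
        rw [inner_neg_right]
        linarith
    -- With this step length the eigenvalue exceeds `6 * ζ₃ * s`, so the curvature gain `3 * ζ₃ * s
    -- ^ 3` beats the remainder `ζ₃ * s ^ 3 / 2`.
    set s := √(ε / ζ₃) with hs
    have hs0 : 0 < s := Real.sqrt_pos.2 (div_pos hε hζ₃)
    have hs2 : s ^ 2 = ε / ζ₃ := Real.sq_sqrt (div_pos hε hζ₃).le
    have hεs : ε = ζ₃ * s ^ 2 := by rw [hs2]; field_simp
    have hsq : √(ζ₃ * ε) = ζ₃ * s := by
      rw [hεs, show ζ₃ * (ζ₃ * s ^ 2) = (ζ₃ * s) ^ 2 by ring, Real.sqrt_sq (by positivity)]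
    rw [hsq] at hlt
    refine ⟨e, hen.le, a + s • e, fun θ => ?_⟩
    have hstep := h.curvature_step hζ₃ θ a hen.le hs0.le
    have hee : inner ℝ (hess (η θstar) a e) e = lam := by
      rw [hHe, real_inner_smul_left, real_inner_self_eq_norm_sq, hen]; ring
    have e1 : inner ℝ (gradient (η θ) a) e = inner ℝ (gradient (η θstar) a) e +
        inner ℝ (gradient (η θ) a - gradient (η θstar) a) e := by
      rw [inner_sub_left]; ring
    have e2 : inner ℝ (hess (η θ) a e) e = lam +
        inner ℝ ((hess (η θ) a - hess (η θstar) a) e) e := by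
      rw [sub_apply, inner_sub_left, hee]; ring
    rw [e1, e2] at hstep
    set D2 := inner ℝ (gradient (η θ) a - gradient (η θstar) a) e
    set D3 := inner ℝ ((hess (η θ) a - hess (η θstar) a) e) e
    have b2 : -(S * |D2|) ≤ s * D2 := by
      have := mul_le_mul_of_nonneg_right hS2 (abs_nonneg D2)
      have := mul_le_mul_of_nonneg_left (neg_abs_le D2) hs0.le
      linarith
    have b3 : -(S * |D3|) ≤ s ^ 2 / 2 * D3 := by
      have hs2S : s ^ 2 / 2 ≤ S := by linarith [sq_nonneg s]
      have := mul_le_mul_of_nonneg_right hs2S (abs_nonneg D3)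
      have := mul_le_mul_of_nonneg_left (neg_abs_le D3) (by positivity : 0 ≤ s ^ 2 / 2)
      linarith
    have b4 : 3 * (ζ₃ * s ^ 3) ≤ s ^ 2 / 2 * lam := by
      have := mul_le_mul_of_nonneg_left hlt.le (by positivity : 0 ≤ s ^ 2 / 2)
      linarith
    -- The curvature gain is of order `ε ^ (3/2)`; since `s` is at most `S`, it is at least the
    -- common gain `c * ε ^ 2` of both cases.
    have b5 : c * ε ^ 2 ≤ ζ₃ * s ^ 3 := by
      have h1 : c * (ζ₃ * s) ≤ 1 := le_trans (by gcongr) hc2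
      calc c * ε ^ 2 = c * (ζ₃ * s) * (ζ₃ * s ^ 3) := by rw [hεs]; ring
        _ ≤ 1 * (ζ₃ * s ^ 3) := mul_le_mul_of_nonneg_right h1 (by positivity)
        _ = _ := one_mul _
    have b6 := mul_nonneg hs0.le hge
    have b7 : 0 < ζ₃ * s ^ 3 := by positivity
    linarith
  · push Not at hg
    set g := gradient (η θstar) a with hgdef
    have hg0 : 0 < ‖g‖ := hε.trans hg
    set e : Act d := (‖g‖⁻¹ : ℝ) • g with he
    have hen : ‖e‖ = 1 := by
      rw [he, norm_smul, norm_inv, norm_norm, inv_mul_cancel₀ hg0.ne']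
    -- This maximizes `s * ε - ζh * s ^ 2 / 2`; the maximum `ε ^ 2 / (2 * ζh)` is the origin of the
    -- bound on `c`.
    set s := ε / ζh with hs
    have hs0 : 0 < s := div_pos hε hζh
    refine ⟨e, hen.le, a + s • e, fun θ => ?_⟩
    have hstep := h.gradient_step θ a hen.le hs0.le
    have hge : inner ℝ g e = ‖g‖ := by
      rw [he, real_inner_smul_right, real_inner_self_eq_norm_sq]; field_simp
    have e1 : inner ℝ (gradient (η θ) a) e = ‖g‖ + inner ℝ (gradient (η θ) a - g) e := by
      rw [inner_sub_left, hge]; ring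
    rw [e1] at hstep
    set D2 := inner ℝ (gradient (η θ) a - g) e
    have b2 : -(S * |D2|) ≤ s * D2 := by
      have := mul_le_mul_of_nonneg_right hS1 (abs_nonneg D2)
      have := mul_le_mul_of_nonneg_left (neg_abs_le D2) hs0.le
      linarith
    have b3 := mul_nonneg hS (abs_nonneg (inner ℝ ((hess (η θ) a - hess (η θstar) a) e) e))
    have b4 : s * ε ≤ s * ‖g‖ := mul_le_mul_of_nonneg_left hg.le hs0.le
    have b5 : c * ε ^ 2 ≤ s * ε - ζh * s ^ 2 / 2 := by
      calc c * ε ^ 2 ≤ 1 / (2 * ζh) * ε ^ 2 := mul_le_mul_of_nonneg_right hc1 (sq_nonneg _)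
        _ = _ := by rw [hs]; field_simp; ring
    linarith

end Improvement

/-! ### Progress of one greedy round -/

section Round

variable {d : ℕ} {Θ : Type*} {η : Θ → Act d → ℝ} {ζg ζh ζ₃ : ℝ}

/-- The loss of the model `θ` on the data point with actions `a, a'`, noise `ξ` and noiseless
supervision by `θstar`. -/
def roundLoss (ζg ζh : ℝ) (η : Θ → Act d → ℝ) (θstar : Θ) (x : Act d × Act d)
    (ξ : Act d × Act d) (θ : Θ) : ℝ :=
  banditLoss ζg ζh η ((x, ξ), response η θstar (x, ξ)) θ

lemma banditLoss_nonneg (z : Input d × (Fin 4 → ℝ)) (θ : Θ) : 0 ≤ banditLoss ζg ζh η z θ := by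
  unfold banditLoss; positivity

lemma response_mem_labelSet (h : RegularReward η ζg ζh ζ₃) (θ : Θ) (x : Input d) :
    response η θ x ∈ labelSet :=
  ⟨h.mem_Icc θ _, h.mem_Icc θ _⟩

lemma banditLoss_self (x : Input d) (θ : Θ) : banditLoss ζg ζh η (x, response η θ x) θ = 0 := by
  simp [banditLoss, sq_nonneg]

/-- An upper bound on the loss. -/
def lossBound (ζg ζh : ℝ) : ℝ := 2 + (2 * ζg) ^ 2 + (640 * √2 * ζh) ^ 2

lemma sq_sub_le_one {x y : ℝ} (hx : x ∈ Set.Icc (0 : ℝ) 1) (hy : y ∈ Set.Icc (0 : ℝ) 1) :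
    (x - y) ^ 2 ≤ 1 := by
  rw [sq_le_one_iff_abs_le_one, abs_le]
  constructor <;> linarith [hx.1, hx.2, hy.1, hy.2]

lemma banditLoss_le (h : RegularReward η ζg ζh ζ₃) {z : Input d × (Fin 4 → ℝ)}
    (hz : z.2 ∈ labelSet) (θ : Θ) : banditLoss ζg ζh η z θ ≤ lossBound ζg ζh := by
  have h0 := sq_sub_le_one (h.mem_Icc θ z.1.1.1) hz.1
  have h1 := sq_sub_le_one (h.mem_Icc θ z.1.1.2) hz.2
  have h2 := min_le_left ((2 * ζg) ^ 2) ((response η θ z.1 2 - z.2 2) ^ 2)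
  have h3 := min_le_left ((640 * √2 * ζh) ^ 2) ((response η θ z.1 3 - z.2 3) ^ 2)
  have e0 : response η θ z.1 0 = η θ z.1.1.1 := rfl
  have e1 : response η θ z.1 1 = η θ z.1.1.2 := rfl
  unfold banditLoss lossBound
  rw [e0, e1]
  linarith

lemma roundLoss_mem_Icc (h : RegularReward η ζg ζh ζ₃) (θstar : Θ) (x ξ : Act d × Act d) (θ : Θ) :
    roundLoss ζg ζh η θstar x ξ θ ∈ Set.Icc 0 (lossBound ζg ζh) :=
  ⟨banditLoss_nonneg _ _, banditLoss_le h (response_mem_labelSet h _ _) _⟩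

lemma integral_const_add_add {α : Type*} [MeasurableSpace α] {μ : Measure α}
    [IsProbabilityMeasure μ] {f g : α → ℝ} (hf : Integrable f μ) (hg : Integrable g μ) (r : ℝ) :
    ∫ x, (r + f x + g x) ∂μ = r + ∫ x, f x ∂μ + ∫ x, g x ∂μ := by
  have hrf : Integrable (fun x => r + f x) μ := (integrable_const r).add hf
  rw [integral_add hrf hg, integral_add (integrable_const r) hf]
  simp

/-- The clipping levels exceed the possible sizes of the gradient difference and of the Hessian form
at `e`, so clipping does not weaken the moment bounds. As `truncMoment` is at most one, its square
is a common factor for all four terms. -/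
lemma le_integral_roundLoss (h : RegularReward η ζg ζh ζ₃)
    (hζh : 0 ≤ ζh) (θstar θ : Θ) (a a' : Act d) {e : Act d} (he : ‖e‖ ≤ 1) :
    truncMoment ^ 2 * ((η θ a - η θstar a) ^ 2 + (η θ a' - η θstar a') ^ 2
      + inner ℝ (gradient (η θ) a' - gradient (η θstar) a') e ^ 2
      + inner ℝ ((hess (η θ) a' - hess (η θstar) a') e) e ^ 2)
      ≤ ∫ ξ, roundLoss ζg ζh η θstar (a, a') ξ θ ∂(noise d) := by
  have hc0 := truncMoment_pos.le
  have hc1 := truncMoment_le_one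
  set w := gradient (η θ) a' - gradient (η θstar) a' with hw
  set H := hess (η θ) a' - hess (η θstar) a' with hH
  have hloss : ∀ ξ : Act d × Act d, roundLoss ζg ζh η θstar (a, a') ξ θ =
      ((η θ a - η θstar a) ^ 2 + (η θ a' - η θstar a') ^ 2)
      + min ((2 * ζg) ^ 2) (inner ℝ w ξ.1 ^ 2)
      + min ((640 * √2 * ζh) ^ 2) (inner ℝ (H ξ.1) ξ.2 ^ 2) := by
    intro ξ
    rw [hw, hH, inner_sub_left, sub_apply, inner_sub_left]
    rfl
  have i2 : Integrable (fun ξ : Act d × Act d => min ((2 * ζg) ^ 2) (inner ℝ w ξ.1 ^ 2))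
      (noise d) :=
    integrable_of_measurable_of_mem_Icc (a := 0) (b := (2 * ζg) ^ 2) (by fun_prop)
      fun x => ⟨by positivity, min_le_left _ _⟩
  have i3 : Integrable (fun ξ : Act d × Act d =>
      min ((640 * √2 * ζh) ^ 2) (inner ℝ (H ξ.1) ξ.2 ^ 2)) (noise d) :=
    integrable_of_measurable_of_mem_Icc (a := 0) (b := (640 * √2 * ζh) ^ 2) (by fun_prop)
      fun x => ⟨by positivity, min_le_left _ _⟩
  simp_rw [hloss]
  rw [integral_const_add_add i2 i3]
  have g2 := truncMoment_mul_le_integral_noise_inner (sq_nonneg (2 * ζg)) w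
  have g3 := truncMoment_sq_mul_le_integral_noise (sq_nonneg (640 * √2 * ζh)) H he
  have hwn : ‖w‖ ≤ 2 * ζg := by
    calc ‖w‖ ≤ ‖gradient (η θ) a'‖ + ‖gradient (η θstar) a'‖ := norm_sub_le _ _
      _ ≤ 2 * ζg := by linarith [h.norm_gradient_le θ a', h.norm_gradient_le θstar a']
  have hHe : |inner ℝ (H e) e| ≤ 640 * √2 * ζh := by
    have h1 : |inner ℝ (H e) e| ≤ 2 * ζh := by
      rw [hH, sub_apply, inner_sub_left]
      refine (abs_sub _ _).trans ?_
      linarith [h.abs_inner_hess_le θ a' he, h.abs_inner_hess_le θstar a' he]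
    have h2 : (1 : ℝ) ≤ √2 := Real.one_le_sqrt.2 (by norm_num)
    nlinarith
  have m2 : inner ℝ w e ^ 2 ≤ min ((2 * ζg) ^ 2) (‖w‖ ^ 2) := by
    rw [min_eq_right (by gcongr), sq_le_sq, abs_norm]
    exact (abs_real_inner_le_norm _ _).trans (mul_le_of_le_one_right (norm_nonneg _) he)
  have m3 : inner ℝ (H e) e ^ 2 = min ((640 * √2 * ζh) ^ 2) (inner ℝ (H e) e ^ 2) := by
    rw [min_eq_right]
    rw [← sq_abs]
    gcongr
  rw [← m3] at g3
  have k1 : truncMoment ^ 2 ≤ 1 := pow_le_one₀ hc0 hc1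
  have k2 : truncMoment ^ 2 ≤ truncMoment := pow_le_of_le_one hc0 hc1 two_ne_zero
  have l1 : truncMoment ^ 2 * ((η θ a - η θstar a) ^ 2 + (η θ a' - η θstar a') ^ 2) ≤
      (η θ a - η θstar a) ^ 2 + (η θ a' - η θstar a') ^ 2 :=
    mul_le_of_le_one_left (by positivity) k1
  have l2 : truncMoment ^ 2 * inner ℝ w e ^ 2 ≤
      truncMoment * min ((2 * ζg) ^ 2) (‖w‖ ^ 2) :=
    mul_le_mul k2 m2 (sq_nonneg _) hc0
  linarith

/-- AM-GM weighted so that four errors together cost `ω / 4`, a fraction of the gain `ω`. -/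
lemma mul_abs_le_add_sq {S ω : ℝ} (hω : 0 < ω) (D : ℝ) :
    S * |D| ≤ ω / 16 + 4 * S ^ 2 / ω * D ^ 2 := by
  have h : 0 ≤ (ω / 4 - 2 * (S * |D|)) ^ 2 / ω := by positivity
  have e : (ω / 4 - 2 * (S * |D|)) ^ 2 / ω = ω / 16 + 4 * S ^ 2 / ω * D ^ 2 - S * |D| := by
    rw [← sq_abs D]; field_simp; ring
  linarith

variable [MeasurableSpace Θ]

lemma measurable_roundLoss (h : RegularReward η ζg ζh ζ₃) (hm : ∀ a, Measurable fun θ => η θ a)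
    (θstar : Θ) : Measurable fun p : Input d × Θ =>
      roundLoss ζg ζh η θstar p.1.1 p.1.2 p.2 := by
  have h0 : Measurable fun p : Input d × Θ => response η θstar p.1 := by
    have h2 := (measurable_response_apply h.contDiff hm θstar).comp
      (measurable_fst : Measurable (Prod.fst : Input d × Θ → Input d))
    simp only [Function.comp_def] at h2
    exact h2
  have h1 : Measurable fun p : Input d × Θ => ((p.1, response η θstar p.1), p.2) := by fun_prop
  have h2 := (measurable_banditLoss ζg ζh h.contDiff hm).comp h1
  simp only [Function.comp_def] at h2
  simp only [roundLoss]
  exact h2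

lemma integrable_roundLoss (h : RegularReward η ζg ζh ζ₃) (hm : ∀ a, Measurable fun θ => η θ a)
    (θstar : Θ) (x : Act d × Act d) (μ : Measure ((Act d × Act d) × Θ)) [IsFiniteMeasure μ] :
    Integrable (fun q : (Act d × Act d) × Θ => roundLoss ζg ζh η θstar x q.1 q.2) μ := by
  have h1 : Measurable fun q : (Act d × Act d) × Θ => ((x, q.1), q.2) := by fun_prop
  have h2 := (measurable_roundLoss h hm θstar).comp h1
  simp only [Function.comp_def] at h2
  exact integrable_of_measurable_of_mem_Icc h2 fun q => roundLoss_mem_Icc h θstar x q.1 q.2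

/-- The progress of one greedy round, for a given improvement of all models at the old action. -/
lemma reward_sub_ge_of_improvement (h : RegularReward η ζg ζh ζ₃)
    (hm : ∀ a, Measurable fun θ => η θ a) (hζh : 0 ≤ ζh) (θstar : Θ)
    (p : Measure Θ) [IsProbabilityMeasure p] {a a' b e : Act d} (he : ‖e‖ ≤ 1)
    (hmax : ∫ θ, η θ b ∂p ≤ ∫ θ, η θ a ∂p) {S ω g : ℝ} (hS : 1 ≤ S) (hω : 0 < ω)
    (himp : ∀ θ, η θ a' + g - S * |inner ℝ (gradient (η θ) a' - gradient (η θstar) a') e|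
        - S * |inner ℝ ((hess (η θ) a' - hess (η θstar) a') e) e| ≤ η θ b) :
    g - ω / 4 - 4 * S ^ 2 / truncMoment ^ 2 / ω *
        ∫ ξ, ∫ θ, roundLoss ζg ζh η θstar (a, a') ξ θ ∂p ∂(noise d)
      ≤ η θstar a - η θstar a' := by
  have hm0 : truncMoment ≠ 0 := truncMoment_pos.ne'
  have hc : 0 < truncMoment ^ 2 := by positivity
  set K := 4 * S ^ 2 / truncMoment ^ 2 / ω with hK
  have hK0 : 0 ≤ K := by positivity
  -- For each model, four errors are traded for squared errors: the rewards at `a` and `a'`, and the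
  -- two derivative errors at `a'` along `e`. Integrating over `p` makes the right side nonpositive,
  -- because the action `a` is greedy and `b` does not depend on `θ`.
  have hpt : ∀ θ, (η θstar a' - η θstar a + g - ω / 4) -
      K * (∫ ξ, roundLoss ζg ζh η θstar (a, a') ξ θ ∂(noise d)) ≤ η θ b - η θ a := by
    intro θ
    have h1 := le_integral_roundLoss h hζh θstar θ a a' he
    have h2 := mul_le_mul_of_nonneg_left h1 hK0
    rw [← mul_assoc, show K * truncMoment ^ 2 = 4 * S ^ 2 / ω by rw [hK]; field_simp] at h2
    have b0 := mul_abs_le_add_sq (S := S) hω (η θ a - η θstar a)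
    have b1 := mul_abs_le_add_sq (S := S) hω (η θ a' - η θstar a')
    have b2 := mul_abs_le_add_sq (S := S) hω
      (inner ℝ (gradient (η θ) a' - gradient (η θstar) a') e)
    have b3 := mul_abs_le_add_sq (S := S) hω
      (inner ℝ ((hess (η θ) a' - hess (η θstar) a') e) e)
    have c0 : η θ a - η θstar a ≤ S * |η θ a - η θstar a| :=
      (le_abs_self _).trans (le_mul_of_one_le_left (abs_nonneg _) hS)
    have c1 : -(η θ a' - η θstar a') ≤ S * |η θ a' - η θstar a'| :=
      (neg_le_abs _).trans (le_mul_of_one_le_left (abs_nonneg _) hS)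
    have := himp θ
    linarith
  have hL := integrable_roundLoss h hm θstar (a, a') ((noise d).prod p)
  have hswap := integral_integral_swap (f := fun ξ θ => roundLoss ζg ζh η θstar (a, a') ξ θ)
    (by simpa only [Function.uncurry_def] using hL)
  rw [hswap]
  have hη : ∀ x, Integrable (fun θ => η θ x) p := fun x =>
    integrable_of_measurable_of_mem_Icc (hm x) fun θ => h.mem_Icc θ x
  have hI : Integrable
      (fun θ => ∫ ξ, roundLoss ζg ζh η θstar (a, a') ξ θ ∂(noise d)) p := hL.integral_prod_right
  have := integral_mono ((integrable_const (η θstar a' - η θstar a + g - ω / 4)).sub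
    (hI.const_mul K)) ((hη b).sub (hη a)) hpt
  simp only [Pi.sub_apply] at this
  rw [integral_sub (integrable_const _) (hI.const_mul K), integral_sub (hη b) (hη a),
    integral_const, probReal_univ, one_smul, integral_const_mul] at this
  linarith

/-- The progress of one greedy round. -/
lemma reward_sub_ge (h : RegularReward η ζg ζh ζ₃)
    (hm : ∀ a, Measurable fun θ => η θ a) (hζh : 0 < ζh) (hζ₃ : 0 < ζ₃) (θstar : Θ)
    (p : Measure Θ) [IsProbabilityMeasure p] {a a' : Act d}
    (hmax : ∀ b, ∫ θ, η θ b ∂p ≤ ∫ θ, η θ a ∂p) {ε S c : ℝ} (hε : 0 < ε) (hS : 1 ≤ S)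
    (hS1 : ε / ζh ≤ S) (hS2 : √(ε / ζ₃) ≤ S) (hS3 : ε / ζ₃ ≤ S)
    (hc0 : 0 < c) (hc1 : c ≤ 1 / (2 * ζh)) (hc2 : c * (ζ₃ * S) ≤ 1) {g : ℝ} (hg : g ≤ c * ε ^ 2)
    (hg' : IsApproxLocalMax (η θstar) ε (6 * √(ζ₃ * ε)) a' → g ≤ 0) :
    g - c * ε ^ 2 / 4 - 4 * S ^ 2 / truncMoment ^ 2 / (c * ε ^ 2) *
        ∫ ξ, ∫ θ, roundLoss ζg ζh η θstar (a, a') ξ θ ∂p ∂(noise d)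
      ≤ η θstar a - η θstar a' := by
  have hω : 0 < c * ε ^ 2 := by positivity
  by_cases ha : IsApproxLocalMax (η θstar) ε (6 * √(ζ₃ * ε)) a'
  -- At a good point the competitor is the old action itself. The direction `e = 0` removes the
  -- derivative errors, so no improvement is claimed but the possible decrease is still controlled.
  · refine reward_sub_ge_of_improvement h hm hζh.le θstar p (b := a') (e := 0) (by simp)
      (hmax a') hS hω fun θ => ?_
    simpa using hg' ha
  · obtain ⟨e, he, b, hb⟩ := h.exists_improvement hζh hζ₃ θstar hε hS1 hS2 hS3 hc1 hc2 hc0.le ha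
    exact reward_sub_ge_of_improvement h hm hζh.le θstar p he (hmax b) hS hω
      fun θ => le_trans (by linarith) (hb θ)

end Round

/-! ### Independence of a new sample from the past -/

section Prefix

variable {α : Type*} [MeasurableSpace α]

lemma measurable_prefixOf {T s : ℕ} (h : s ≤ T) : Measurable (prefixOf (α := α) h) :=
  measurable_pi_iff.2 fun _ => measurable_pi_apply _

lemma measurable_finInit {s : ℕ} : Measurable fun z : Fin (s + 1) → α => (Fin.init z : Fin s → α) :=
  measurable_pi_iff.2 fun _ => measurable_pi_apply _

lemma measurable_finSnoc {β : Type*} [MeasurableSpace β] {s : ℕ} {f : β → Fin s → α} {g : β → α}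
    (hf : Measurable f) (hg : Measurable g) :
    Measurable fun b => (Fin.snoc (f b) (g b) : Fin (s + 1) → α) := by
  refine measurable_pi_iff.2 fun i => ?_
  induction i using Fin.lastCases with
  | last => simpa using hg
  | cast i => simpa [Function.comp_def] using (measurable_pi_apply i).comp hf

/-- The preimage of a box is a box whose additional sides are the whole space, and these contribute
factors of one. -/
lemma measurePreserving_prefixOf (q : Measure α) [IsProbabilityMeasure q] {T s : ℕ} (h : s ≤ T) :
    MeasurePreserving (prefixOf (α := α) h) (Measure.pi fun _ : Fin T => q)
      (Measure.pi fun _ : Fin s => q) := by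
  refine ⟨measurable_prefixOf h, (Measure.pi_eq fun S hS => ?_).symm⟩
  rw [Measure.map_apply (measurable_prefixOf h) (MeasurableSet.univ_pi hS)]
  have hset : prefixOf h ⁻¹' Set.univ.pi S =
      Set.univ.pi fun i : Fin T => if hi : (i : ℕ) < s then S ⟨i, hi⟩ else Set.univ := by
    ext z
    simp only [Set.mem_preimage, Set.mem_univ_pi]
    constructor
    · intro hz i
      by_cases hi : (i : ℕ) < s
      · simp only [hi, dite_true]
        exact hz ⟨i, hi⟩
      · simp [hi]
    · intro hz i
      have hi := hz (Fin.castLE h i)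
      simp only [Fin.val_castLE, i.isLt, dite_true] at hi
      exact hi
  rw [hset, Measure.pi_pi]
  refine (Fintype.prod_of_injective (Fin.castLE h) (Fin.castLE_injective h) _ _ ?_ ?_).symm
  · intro i hi
    have : ¬ (i : ℕ) < s := fun hlt => hi ⟨⟨i, hlt⟩, rfl⟩
    simp [this]
  · intro i
    simp

/-- The coordinate of round `t` is independent of the coordinates of the earlier rounds. -/
lemma integral_prefixOf_prod (q : Measure α) [IsProbabilityMeasure q] {T : ℕ} (t : Fin T)
    {G : (Fin t → α) × α → ℝ} (hG : Measurable G) {b : ℝ} (hb : ∀ z, G z ∈ Set.Icc 0 b) :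
    ∫ ξ, G (prefixOf t.isLt.le ξ, ξ t) ∂(Measure.pi fun _ : Fin T => q) =
      ∫ ξ, ∫ y, G (prefixOf t.isLt.le ξ, y) ∂q ∂(Measure.pi fun _ : Fin T => q) := by
  -- Only the first `t + 1` coordinates matter; the last of these is then split off as an
  -- independent factor.
  have h1 : ∫ ξ, G (prefixOf t.isLt.le ξ, ξ t) ∂(Measure.pi fun _ : Fin T => q) =
      ∫ z, G (Fin.init z, z (Fin.last t)) ∂(Measure.pi fun _ : Fin (t + 1) => q) := by
    have hmp := measurePreserving_prefixOf q (Nat.succ_le_of_lt t.isLt)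
    have hm : Measurable fun z : Fin (t + 1) → α => G (Fin.init z, z (Fin.last t)) :=
      hG.comp (measurable_finInit.prodMk (measurable_pi_apply _))
    rw [← hmp.map_eq, integral_map hmp.measurable.aemeasurable hm.aestronglyMeasurable]
    rfl
  have h2 : ∫ z, G (Fin.init z, z (Fin.last t)) ∂(Measure.pi fun _ : Fin (t + 1) => q) =
      ∫ w : α × (Fin t → α), G (w.2, w.1) ∂(q.prod (Measure.pi fun _ : Fin t => q)) := by
    have hmp := measurePreserving_piFinSuccAbove (fun _ : Fin (t + 1) => q) (Fin.last t)
    have hm : Measurable fun w : α × (Fin t → α) => G (w.2, w.1) := hG.comp measurable_swap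
    rw [← hmp.map_eq, integral_map hmp.measurable.aemeasurable hm.aestronglyMeasurable]
    refine integral_congr_ae (Filter.Eventually.of_forall fun z => ?_)
    simp only [MeasurableEquiv.piFinSuccAbove_apply, Fin.insertNthEquiv_symm_apply]
    congr 2
    ext i
    simp [Fin.removeNth, Fin.init]
  have h3 : Integrable (fun w : α × (Fin t → α) => G (w.2, w.1))
      (q.prod (Measure.pi fun _ : Fin t => q)) :=
    integrable_of_measurable_of_mem_Icc (hG.comp measurable_swap) fun w => hb _
  have hmp := measurePreserving_prefixOf q t.isLt.le
  have hm : StronglyMeasurable fun z : Fin t → α => ∫ y, G (z, y) ∂q :=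
    StronglyMeasurable.integral_prod_right' (f := G) hG.stronglyMeasurable
  rw [h1, h2, integral_prod_symm _ h3]
  rw [← hmp.map_eq, integral_map hmp.measurable.aemeasurable hm.aestronglyMeasurable]

end Prefix

/-! ### Outer expectation of integrable functions -/

section OuterExp

lemma integral_le_outerExp {Ω : Type*} [MeasurableSpace Ω] {μ : Measure Ω} {f : Ω → ℝ}
    (hf : Integrable f μ) : ∫ ω, f ω ∂μ ≤ outerExp μ f := by
  refine le_csInf ⟨_, f, hf, fun _ => le_rfl, rfl⟩ ?_
  rintro r ⟨g, hg, hfg, rfl⟩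
  exact integral_mono hf hg hfg

end OuterExp

/-! ### The algorithm as an adversary, and its cumulative loss -/

section Run

variable {d : ℕ} {Θ : Type*} {η : Θ → Act d → ℝ} {ζg ζh ζ₃ : ℝ}

/-- The pair of actions `(a_{s+1}, a_s)` of the algorithm, as a function of the first `s` samples. -/
def violinActions (η : Θ → Act d → ℝ) (θstar : Θ) (a₀ : Act d) (sel : ActionRule d) (s : ℕ)
    (z : Fin s → Act d × Act d) : Act d × Act d :=
  (sel s (violin η θstar a₀ sel s z).2, (violin η θstar a₀ sel s z).1)

/-- The supervision of the algorithm in round `s + 1`. -/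
def violinLabel (η : Θ → Act d → ℝ) (θstar : Θ) (a₀ : Act d) (sel : ActionRule d) (s : ℕ)
    (z : Fin (s + 1) → Act d × Act d) : Fin 4 → ℝ :=
  response η θstar (violinActions η θstar a₀ sel s (Fin.init z), z (Fin.last s))

/-- Identifies the run with the play of an adversary whose moves are functions of the samples, which
is the form that the regret guarantee requires. -/
lemma violin_history (θstar : Θ) (a₀ : Act d) (sel : ActionRule d) {T : ℕ}
    (ξ : Fin T → Act d × Act d) : ∀ (s : ℕ) (h : s ≤ T),
      (violin η θstar a₀ sel s (prefixOf h ξ)).2 =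
        prefixOf h (dataPoint (fun t => violinActions η θstar a₀ sel t)
          (fun t => violinLabel η θstar a₀ sel t) ξ)
  | 0, h => funext fun i => i.elim0
  | s + 1, h => by
    have ih := violin_history θstar a₀ sel ξ s (Nat.le_of_succ_le h)
    funext i
    induction i using Fin.lastCases with
    | last =>
      simp only [violin, Fin.snoc_last]
      rfl
    | cast i =>
      simp only [violin, Fin.snoc_castSucc]
      exact congrFun ih i

variable [MeasurableSpace Θ]

lemma measurable_violin (h : RegularReward η ζg ζh ζ₃) (hm : ∀ a, Measurable fun θ => η θ a)
    (θstar : Θ) (a₀ : Act d) {sel : ActionRule d} (hsel : ∀ s, Measurable (sel s)) :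
    ∀ s, Measurable (violin η θstar a₀ sel s)
  | 0 => by
    have : violin η θstar a₀ sel 0 = fun _ => (a₀, Fin.elim0) := by funext; rfl
    rw [this]
    exact measurable_const
  | s + 1 => by
    have ih := (measurable_violin h hm θstar a₀ hsel s).comp measurable_finInit
    simp only [Function.comp_def] at ih
    have ha : Measurable fun ξ : Fin (s + 1) → Act d × Act d =>
        sel s (violin η θstar a₀ sel s (Fin.init ξ)).2 := (hsel s).comp ih.snd
    have hx : Measurable fun ξ : Fin (s + 1) → Act d × Act d =>
        (((sel s (violin η θstar a₀ sel s (Fin.init ξ)).2,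
          (violin η θstar a₀ sel s (Fin.init ξ)).1), ξ (Fin.last s)) : Input d) :=
      (ha.prodMk ih.fst).prodMk (measurable_pi_apply _)
    have hr := (measurable_response_apply h.contDiff hm θstar).comp hx
    simp only [Function.comp_def] at hr
    exact ha.prodMk (measurable_finSnoc ih.snd (hx.prodMk hr))

lemma measurable_violinActions (h : RegularReward η ζg ζh ζ₃)
    (hm : ∀ a, Measurable fun θ => η θ a) (θstar : Θ) (a₀ : Act d) {sel : ActionRule d}
    (hsel : ∀ s, Measurable (sel s)) (s : ℕ) : Measurable (violinActions η θstar a₀ sel s) := by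
  have hv := measurable_violin h hm θstar a₀ hsel s
  exact ((hsel s).comp hv.snd).prodMk hv.fst

lemma measurable_violinLabel (h : RegularReward η ζg ζh ζ₃)
    (hm : ∀ a, Measurable fun θ => η θ a) (θstar : Θ) (a₀ : Act d) {sel : ActionRule d}
    (hsel : ∀ s, Measurable (sel s)) (s : ℕ) : Measurable (violinLabel η θstar a₀ sel s) := by
  have hx : Measurable fun z : Fin (s + 1) → Act d × Act d =>
      ((violinActions η θstar a₀ sel s (Fin.init z), z (Fin.last s)) : Input d) :=
    ((measurable_violinActions h hm θstar a₀ hsel s).comp measurable_finInit).prodMk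
      (measurable_pi_apply _)
  have hr := (measurable_response_apply h.contDiff hm θstar).comp hx
  simp only [Function.comp_def] at hr
  exact hr

/-- The expected loss of the learner in round `s + 1`, given the first `s` samples and the sample of
the round. -/
def learnerLoss (ζg ζh : ℝ) (η : Θ → Act d → ℝ) (θstar : Θ) (a₀ : Act d) (sel : ActionRule d)
    (A : BanditLearner d Θ) (s : ℕ) (w : (Fin s → Act d × Act d) × (Act d × Act d)) : ℝ :=
  ∫ θ, roundLoss ζg ζh η θstar (violinActions η θstar a₀ sel s w.1) w.2 θ
    ∂(A s (violin η θstar a₀ sel s w.1).2)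

lemma measurable_learnerLoss (h : RegularReward η ζg ζh ζ₃)
    (hm : ∀ a, Measurable fun θ => η θ a) (θstar : Θ) (a₀ : Act d) {sel : ActionRule d}
    (hsel : ∀ s, Measurable (sel s)) (A : BanditLearner d Θ) (hA : ∀ s, IsMarkovKernel (A s))
    (s : ℕ) : Measurable (learnerLoss ζg ζh η θstar a₀ sel A s) := by
  have := hA s
  have hhist : Measurable fun w : (Fin s → Act d × Act d) × (Act d × Act d) =>
      (violin η θstar a₀ sel s w.1).2 :=
    (measurable_violin h hm θstar a₀ hsel s).snd.comp measurable_fst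
  have h1 : Measurable fun p : ((Fin s → Act d × Act d) × (Act d × Act d)) × Θ =>
      (((violinActions η θstar a₀ sel s p.1.1, p.1.2), p.2) : Input d × Θ) :=
    (((measurable_violinActions h hm θstar a₀ hsel s).comp
      (measurable_fst.comp measurable_fst)).prodMk (measurable_snd.comp measurable_fst)).prodMk
      measurable_snd
  have h2 := (measurable_roundLoss h hm θstar).comp h1
  simp only [Function.comp_def] at h2
  have h3 := StronglyMeasurable.integral_kernel_prod_right' (κ := (A s).comap _ hhist)
    h2.stronglyMeasurable
  simp only [Kernel.comap_apply] at h3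
  exact h3.measurable

lemma learnerLoss_mem_Icc (h : RegularReward η ζg ζh ζ₃) (hm : ∀ a, Measurable fun θ => η θ a)
    (θstar : Θ) (a₀ : Act d) (sel : ActionRule d)
    (A : BanditLearner d Θ) (hA : ∀ s, IsMarkovKernel (A s)) (s : ℕ)
    (w : (Fin s → Act d × Act d) × (Act d × Act d)) :
    learnerLoss ζg ζh η θstar a₀ sel A s w ∈ Set.Icc 0 (lossBound ζg ζh) := by
  have := hA s
  have hb := roundLoss_mem_Icc h θstar (violinActions η θstar a₀ sel s w.1) w.2
  refine ⟨integral_nonneg fun θ => (hb θ).1, ?_⟩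
  have h1 : Measurable fun θ : Θ =>
      (((violinActions η θstar a₀ sel s w.1, w.2), θ) : Input d × Θ) := by fun_prop
  have h2 := (measurable_roundLoss h hm θstar).comp h1
  simp only [Function.comp_def] at h2
  calc learnerLoss ζg ζh η θstar a₀ sel A s w
      ≤ ∫ _, lossBound ζg ζh ∂(A s (violin η θstar a₀ sel s w.1).2) :=
        integral_mono (integrable_of_measurable_of_mem_Icc h2 hb) (integrable_const _)
          fun θ => (hb θ).2
    _ = lossBound ζg ζh := by simp

/-- The expected cumulative loss of the learner along the run of the algorithm. -/
lemma integral_sum_learnerLoss_le (h : RegularReward η ζg ζh ζ₃)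
    (hm : ∀ a, Measurable fun θ => η θ a) (θstar : Θ) (a₀ : Act d) {sel : ActionRule d}
    (hsel : ∀ s, Measurable (sel s)) (A : BanditLearner d Θ) (hA : ∀ s, IsMarkovKernel (A s))
    {T : ℕ} (hreg : HasRademacherRegret (noise d) labelSet (banditLoss ζg ζh η) A T) :
    ∫ ξ, ∑ t : Fin T, learnerLoss ζg ζh η θstar a₀ sel A t (prefixOf t.isLt.le ξ, ξ t)
        ∂(Measure.pi fun _ : Fin T => noise d)
      ≤ 2 * seqRademacher (noise d) labelSet (banditLoss ζg ζh η) T := by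
  have hr := hreg (fun t => violinActions η θstar a₀ sel t) (fun t => violinLabel η θstar a₀ sel t)
    (fun t => measurable_violinActions h hm θstar a₀ hsel t)
    (fun t => measurable_violinLabel h hm θstar a₀ hsel t)
    (fun t ξ => response_mem_labelSet h θstar _)
  refine le_trans ?_ hr
  have hfun : (fun ξ : Fin T → Act d × Act d =>
      (∑ t : Fin T, ∫ θ, banditLoss ζg ζh η
        (dataPoint (fun t => violinActions η θstar a₀ sel t)
          (fun t => violinLabel η θstar a₀ sel t) ξ t) θ
        ∂(A t (prefixOf t.isLt.le (dataPoint (fun t => violinActions η θstar a₀ sel t)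
          (fun t => violinLabel η θstar a₀ sel t) ξ))))
      - ⨅ θ : Θ, ∑ t : Fin T, banditLoss ζg ζh η
        (dataPoint (fun t => violinActions η θstar a₀ sel t)
          (fun t => violinLabel η θstar a₀ sel t) ξ t) θ) =
      fun ξ => ∑ t : Fin T,
        learnerLoss ζg ζh η θstar a₀ sel A t (prefixOf t.isLt.le ξ, ξ t) := by
    funext ξ
    -- Losses are nonnegative and `θstar` generates the labels, so the comparator term is zero.
    have hinf : ⨅ θ : Θ, ∑ t : Fin T, banditLoss ζg ζh η
        (dataPoint (fun t => violinActions η θstar a₀ sel t)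
          (fun t => violinLabel η θstar a₀ sel t) ξ t) θ = 0 := by
      have h0 : ∀ θ : Θ, 0 ≤ ∑ t : Fin T, banditLoss ζg ζh η
          (dataPoint (fun t => violinActions η θstar a₀ sel t)
            (fun t => violinLabel η θstar a₀ sel t) ξ t) θ :=
        fun θ => Finset.sum_nonneg fun t _ => banditLoss_nonneg _ _
      refine le_antisymm ?_ (Real.iInf_nonneg h0)
      refine (ciInf_le ⟨0, by rintro _ ⟨θ, rfl⟩; exact h0 θ⟩ θstar).trans_eq ?_
      exact Finset.sum_eq_zero fun t _ => banditLoss_self _ _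
    rw [hinf, sub_zero]
    refine Finset.sum_congr rfl fun t _ => ?_
    rw [← violin_history]
    rfl
  unfold onlineRegret
  rw [hfun]
  refine integral_le_outerExp (integrable_finsetSum _ fun t _ => ?_)
  refine integrable_of_measurable_of_mem_Icc ?_
    fun ξ => learnerLoss_mem_Icc h hm θstar a₀ sel A hA t _
  exact (measurable_learnerLoss h hm θstar a₀ hsel A hA t).comp
    ((measurable_prefixOf _).prodMk (measurable_pi_apply _))

end Run

/-! ### Telescoping the progress over all rounds -/

section Progress

variable {d : ℕ} {Θ : Type*} {η : Θ → Act d → ℝ} {ζg ζh ζ₃ : ℝ}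

/-- The action `a_t` (`t ≤ T`) of the algorithm as a function of all samples. -/
def violinAction (η : Θ → Act d → ℝ) (θstar : Θ) (a₀ : Act d) (sel : ActionRule d) {T : ℕ}
    (i : Fin (T + 1)) (ξ : Fin T → Act d × Act d) : Act d :=
  (violin η θstar a₀ sel i (prefixOf (Nat.lt_succ_iff.1 i.isLt) ξ)).1

lemma violinAction_castSucc (θstar : Θ) (a₀ : Act d) (sel : ActionRule d) {T : ℕ} (t : Fin T)
    (ξ : Fin T → Act d × Act d) : violinAction η θstar a₀ sel t.castSucc ξ =
      (violinActions η θstar a₀ sel t (prefixOf t.isLt.le ξ)).2 := rfl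

lemma violinAction_succ (θstar : Θ) (a₀ : Act d) (sel : ActionRule d) {T : ℕ} (t : Fin T)
    (ξ : Fin T → Act d × Act d) : violinAction η θstar a₀ sel t.succ ξ =
      (violinActions η θstar a₀ sel t (prefixOf t.isLt.le ξ)).1 := rfl

lemma sum_fin_succ_sub_castSucc {T : ℕ} (F : Fin (T + 1) → ℝ) :
    ∑ t : Fin T, (F t.succ - F t.castSucc) = F (Fin.last T) - F 0 := by
  have h1 := Fin.sum_univ_succ F
  have h2 := Fin.sum_univ_castSucc F
  rw [Finset.sum_sub_distrib]
  linarith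

variable [MeasurableSpace Θ]

/-- The progress bound conditioned on the past: `z` determines both actions and the learner's
distribution, and only the new sample is averaged. -/
lemma violin_progress (h : RegularReward η ζg ζh ζ₃)
    (hm : ∀ a, Measurable fun θ => η θ a) (hζh : 0 < ζh) (hζ₃ : 0 < ζ₃) (θstar : Θ) (a₀ : Act d)
    {sel : ActionRule d} (A : BanditLearner d Θ) (hA : ∀ s, IsMarkovKernel (A s)) {T : ℕ}
    (hsel : IsGreedyRule η θstar a₀ A T sel) {ε S c : ℝ} (hε : 0 < ε) (hS : 1 ≤ S)
    (hS1 : ε / ζh ≤ S) (hS2 : √(ε / ζ₃) ≤ S) (hS3 : ε / ζ₃ ≤ S)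
    (hc0 : 0 < c) (hc1 : c ≤ 1 / (2 * ζh)) (hc2 : c * (ζ₃ * S) ≤ 1)
    {s : ℕ} (hs : s < T) (z : Fin s → Act d × Act d) {g : ℝ} (hg : g ≤ c * ε ^ 2)
    (hg' : IsApproxLocalMax (η θstar) ε (6 * √(ζ₃ * ε)) (violinActions η θstar a₀ sel s z).2 →
      g ≤ 0) :
    g - c * ε ^ 2 / 4 - 4 * S ^ 2 / truncMoment ^ 2 / (c * ε ^ 2) *
        ∫ y, learnerLoss ζg ζh η θstar a₀ sel A s (z, y) ∂(noise d) ≤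
      η θstar (violinActions η θstar a₀ sel s z).1 -
        η θstar (violinActions η θstar a₀ sel s z).2 := by
  have hA' := hA s
  have hmax : ∀ b, ∫ θ, η θ b ∂(A s (violin η θstar a₀ sel s z).2) ≤
      ∫ θ, η θ (violinActions η θstar a₀ sel s z).1 ∂(A s (violin η θstar a₀ sel s z).2) :=
    fun b => hsel.2 s hs z (Set.mem_univ b)
  have := reward_sub_ge h hm hζh hζ₃ θstar (A s (violin η θstar a₀ sel s z).2) hmax hε hS hS1 hS2
    hS3 hc0 hc1 hc2 hg hg'
  simpa only [learnerLoss] using this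

lemma integrable_integral_learnerLoss (h : RegularReward η ζg ζh ζ₃)
    (hm : ∀ a, Measurable fun θ => η θ a) (θstar : Θ) (a₀ : Act d) {sel : ActionRule d}
    (hsel : ∀ s, Measurable (sel s)) (A : BanditLearner d Θ) (hA : ∀ s, IsMarkovKernel (A s))
    {T : ℕ} (t : Fin T) (μ : Measure (Fin T → Act d × Act d)) [IsFiniteMeasure μ] :
    Integrable (fun ξ : Fin T → Act d × Act d =>
      ∫ y, learnerLoss ζg ζh η θstar a₀ sel A t (prefixOf t.isLt.le ξ, y) ∂(noise d)) μ := by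
  have hLm := measurable_learnerLoss (ζg := ζg) (ζh := ζh) h hm θstar a₀ hsel A hA t
  have hb := learnerLoss_mem_Icc (ζg := ζg) (ζh := ζh) h hm θstar a₀ sel A hA t
  have h1 : Measurable fun z : Fin t → Act d × Act d =>
      ∫ y, learnerLoss ζg ζh η θstar a₀ sel A t (z, y) ∂(noise d) :=
    (StronglyMeasurable.integral_prod_right' (ν := noise d) hLm.stronglyMeasurable).measurable
  refine integrable_of_measurable_of_mem_Icc (a := 0) (b := lossBound ζg ζh)
    (h1.comp (measurable_prefixOf t.isLt.le)) fun ξ =>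
    ⟨integral_nonneg fun y => (hb _).1, ?_⟩
  have hi : Integrable (fun y =>
      learnerLoss ζg ζh η θstar a₀ sel A t (prefixOf t.isLt.le ξ, y)) (noise d) :=
    integrable_of_measurable_of_mem_Icc (hLm.comp measurable_prodMk_left) fun y => hb _
  calc ∫ y, learnerLoss ζg ζh η θstar a₀ sel A t (prefixOf t.isLt.le ξ, y) ∂(noise d)
      ≤ ∫ _, lossBound ζg ζh ∂(noise d) :=
        integral_mono hi (integrable_const _) fun y => (hb _).2
    _ = lossBound ζg ζh := by simp

/-- Summed progress of the algorithm: the rounds that start at a point that is not an approximate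
local maximum are paid for by the total reward and the regret. -/
lemma progress_sum (h : RegularReward η ζg ζh ζ₃)
    (hm : ∀ a, Measurable fun θ => η θ a) (hζh : 0 < ζh) (hζ₃ : 0 < ζ₃) (θstar : Θ) (a₀ : Act d)
    {sel : ActionRule d} (A : BanditLearner d Θ) (hA : ∀ s, IsMarkovKernel (A s)) {T : ℕ}
    (hreg : HasRademacherRegret (noise d) labelSet (banditLoss ζg ζh η) A T)
    (hsel : IsGreedyRule η θstar a₀ A T sel) {ε S c : ℝ} (hε : 0 < ε) (hS : 1 ≤ S)
    (hS1 : ε / ζh ≤ S) (hS2 : √(ε / ζ₃) ≤ S) (hS3 : ε / ζ₃ ≤ S)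
    (hc0 : 0 < c) (hc1 : c ≤ 1 / (2 * ζh)) (hc2 : c * (ζ₃ * S) ≤ 1)
    {B : Fin T → Set (Fin T → Act d × Act d)} (hB : ∀ t, MeasurableSet (B t))
    (hBbad : ∀ t, ∀ ξ ∈ B t, ¬ IsApproxLocalMax (η θstar) ε (6 * √(ζ₃ * ε))
      (violinAction η θstar a₀ sel t.castSucc ξ)) :
    c * ε ^ 2 * ∑ t, (Measure.pi fun _ : Fin T => noise d).real (B t) - T * (c * ε ^ 2 / 4)
      - 4 * S ^ 2 / truncMoment ^ 2 / (c * ε ^ 2) *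
        (2 * seqRademacher (noise d) labelSet (banditLoss ζg ζh η) T) ≤ 1 := by
  set μ := Measure.pi fun _ : Fin T => noise d with hμ
  set ω := c * ε ^ 2 with hω
  have hω0 : 0 < ω := by positivity
  set K := 4 * S ^ 2 / truncMoment ^ 2 / ω with hK
  have hK0 : 0 ≤ K := by positivity
  have hLm : ∀ t : Fin T, Measurable fun ξ : Fin T → Act d × Act d =>
      learnerLoss ζg ζh η θstar a₀ sel A t (prefixOf t.isLt.le ξ, ξ t) := fun t =>
    (measurable_learnerLoss h hm θstar a₀ hsel.1 A hA t).comp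
      ((measurable_prefixOf _).prodMk (measurable_pi_apply _))
  have hLi : ∀ t : Fin T, Integrable (fun ξ : Fin T → Act d × Act d =>
      learnerLoss ζg ζh η θstar a₀ sel A t (prefixOf t.isLt.le ξ, ξ t)) μ := fun t =>
    integrable_of_measurable_of_mem_Icc (hLm t)
      fun ξ => learnerLoss_mem_Icc h hm θstar a₀ sel A hA t _
  have hact : ∀ i : Fin (T + 1), Integrable
      (fun ξ => η θstar (violinAction η θstar a₀ sel i ξ)) μ := fun i => by
    refine integrable_of_measurable_of_mem_Icc ?_ fun ξ => h.mem_Icc θstar _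
    exact (h.contDiff θstar).continuous.measurable.comp
      ((measurable_violin h hm θstar a₀ hsel.1 i).fst.comp (measurable_prefixOf _))
  have hround : ∀ t : Fin T, ω * μ.real (B t) - ω / 4 -
      K * ∫ ξ, learnerLoss ζg ζh η θstar a₀ sel A t (prefixOf t.isLt.le ξ, ξ t) ∂μ ≤
        ∫ ξ, η θstar (violinAction η θstar a₀ sel t.succ ξ) ∂μ -
          ∫ ξ, η θstar (violinAction η θstar a₀ sel t.castSucc ξ) ∂μ := by
    intro t
    -- The claimed gain `g` is `ω` on `B t` and zero elsewhere, which is admissible because `B t`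
    -- contains only bad outcomes.
    have hpt : ∀ ξ : Fin T → Act d × Act d, (B t).indicator (fun _ => ω) ξ - ω / 4 -
        K * ∫ y, learnerLoss ζg ζh η θstar a₀ sel A t (prefixOf t.isLt.le ξ, y) ∂(noise d) ≤
          η θstar (violinAction η θstar a₀ sel t.succ ξ) -
            η θstar (violinAction η θstar a₀ sel t.castSucc ξ) := by
      intro ξ
      rw [violinAction_succ, violinAction_castSucc]
      refine violin_progress h hm hζh hζ₃ θstar a₀ A hA hsel hε hS hS1 hS2 hS3 hc0 hc1 hc2
        t.isLt (prefixOf t.isLt.le ξ) (Set.indicator_le_self' (fun _ _ => hω0.le) ξ) fun hgood => ?_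
      by_cases hξ : ξ ∈ B t
      · exact absurd hgood (hBbad t ξ hξ)
      · simp [hξ]
    have hi2 := integrable_integral_learnerLoss (ζg := ζg) (ζh := ζh) h hm θstar a₀ hsel.1 A hA t μ
    -- The sample of the round is independent of the past, so the loss along the run has the same
    -- expectation as the conditional average in `hpt`.
    rw [integral_prefixOf_prod (noise d) t (measurable_learnerLoss h hm θstar a₀ hsel.1 A hA t)
      (learnerLoss_mem_Icc h hm θstar a₀ sel A hA t), ← integral_sub (hact _) (hact _)]
    have hind : Integrable ((B t).indicator fun _ => ω) μ := (integrable_const ω).indicator (hB t)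
    have hmono := integral_mono ((hind.sub (integrable_const (ω / 4))).sub (hi2.const_mul K))
      ((hact t.succ).sub (hact t.castSucc)) hpt
    simp only [Pi.sub_apply] at hmono
    have hind' : Integrable (fun ξ => (B t).indicator (fun _ => ω) ξ - ω / 4) μ :=
      hind.sub (integrable_const _)
    rw [integral_sub hind' (hi2.const_mul K), integral_sub hind (integrable_const _),
      integral_indicator_const _ (hB t), integral_const, probReal_univ, one_smul,
      integral_const_mul, smul_eq_mul, mul_comm] at hmono
    exact hmono
  have hsum := Finset.sum_le_sum fun t (_ : t ∈ Finset.univ) => hround t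
  rw [sum_fin_succ_sub_castSucc
    (fun i => ∫ ξ, η θstar (violinAction η θstar a₀ sel i ξ) ∂μ)] at hsum
  simp only [Finset.sum_sub_distrib, ← Finset.mul_sum, Finset.sum_const, Finset.card_univ,
    Fintype.card_fin, nsmul_eq_mul] at hsum
  rw [← integral_finsetSum _ fun t _ => hLi t] at hsum
  have hregret := mul_le_mul_of_nonneg_left
    (integral_sum_learnerLoss_le h hm θstar a₀ hsel.1 A hA hreg) hK0
  have hlast : ∫ ξ, η θstar (violinAction η θstar a₀ sel (Fin.last T) ξ) ∂μ ≤ 1 := by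
    refine (integral_mono (hact _) (integrable_const 1) fun ξ => (h.mem_Icc θstar _).2).trans_eq ?_
    simp
  have hfirst : 0 ≤ ∫ ξ, η θstar (violinAction η θstar a₀ sel (0 : Fin (T + 1)) ξ) ∂μ :=
    integral_nonneg fun ξ => (h.mem_Icc θstar _).1
  linarith

/-- If no action of the algorithm is an approximate local maximum with probability at least `1/2`,
then the number of rounds is bounded in terms of the sequential Rademacher complexity. -/
lemma rounds_le_of_actionProb_lt (h : RegularReward η ζg ζh ζ₃)
    (hm : ∀ a, Measurable fun θ => η θ a) (hζh : 0 < ζh) (hζ₃ : 0 < ζ₃) (θstar : Θ) (a₀ : Act d)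
    {sel : ActionRule d} (A : BanditLearner d Θ) (hA : ∀ s, IsMarkovKernel (A s)) {T : ℕ}
    (hreg : HasRademacherRegret (noise d) labelSet (banditLoss ζg ζh η) A T)
    (hsel : IsGreedyRule η θstar a₀ A T sel) {ε S c : ℝ} (hε : 0 < ε) (hS : 1 ≤ S)
    (hS1 : ε / ζh ≤ S) (hS2 : √(ε / ζ₃) ≤ S) (hS3 : ε / ζ₃ ≤ S)
    (hc0 : 0 < c) (hc1 : c ≤ 1 / (2 * ζh)) (hc2 : c * (ζ₃ * S) ≤ 1)
    (hprob : ∀ (t : ℕ) (ht : t ≤ T), 1 ≤ t → actionProb η θstar a₀ sel ht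
      (IsApproxLocalMax (η θstar) ε (6 * √(ζ₃ * ε))) < 1 / 2) :
    c * ε ^ 2 * ((T - 1) / 2) - T * (c * ε ^ 2 / 4)
      - 4 * S ^ 2 / truncMoment ^ 2 / (c * ε ^ 2) *
        (2 * seqRademacher (noise d) labelSet (banditLoss ζg ζh η) T) ≤ 1 := by
  set μ := Measure.pi fun _ : Fin T => noise d with hμ
  -- The good event is not known to be measurable. Its measurable hull has the same outer measure,
  -- and the complement of the hull is a measurable set of bad outcomes.
  set G : Fin T → Set (Fin T → Act d × Act d) := fun t => toMeasurable μ
    {ξ | IsApproxLocalMax (η θstar) ε (6 * √(ζ₃ * ε))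
      (violinAction η θstar a₀ sel t.castSucc ξ)} with hG
  have hp := progress_sum h hm hζh hζ₃ θstar a₀ A hA hreg hsel hε hS hS1 hS2 hS3 hc0 hc1 hc2
    (B := fun t => (G t)ᶜ) (fun t => (measurableSet_toMeasurable _ _).compl)
    fun t ξ hξ hgood => hξ (subset_toMeasurable μ _ hgood)
  -- The arbitrary initial action is excluded, since nothing is assumed about it; this is why `T -
  -- 1` appears.
  have hreal : ∀ t : Fin T, (t : ℕ) ≠ 0 → 1 / 2 ≤ μ.real ((G t)ᶜ) := by
    intro t ht
    have h1 := hprob t t.isLt.le (Nat.one_le_iff_ne_zero.2 ht)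
    have h2 : μ.real (G t) < 1 / 2 := by
      rw [hG, measureReal_def, measure_toMeasurable]
      exact h1
    rw [probReal_compl_eq_one_sub (measurableSet_toMeasurable _ _)]
    linarith
  have hsum : ((T : ℝ) - 1) / 2 ≤ ∑ t : Fin T, μ.real ((G t)ᶜ) := by
    rcases T with _ | n
    · norm_num
    · rw [Fin.sum_univ_succ]
      have h1 := Finset.sum_le_sum fun (i : Fin n) (_ : i ∈ Finset.univ) =>
        hreal i.succ (by simp)
      simp only [Finset.sum_const, Finset.card_univ, Fintype.card_fin, nsmul_eq_mul] at h1
      have h2 : 0 ≤ μ.real ((G 0)ᶜ) := measureReal_nonneg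
      push_cast
      linarith
  have hω0 : 0 ≤ c * ε ^ 2 := by positivity
  have := mul_le_mul_of_nonneg_left hsum hω0
  linarith

end Progress

/-! ### Absorbing the logarithms of the horizon -/

/-- The polylogarithmic condition on the horizon absorbs the powers of `log T`. -/
lemma exists_const_mul_log_pow_le (C₁ C₂ : ℝ) (hC₁ : 0 ≤ C₁) (k : ℕ) :
    ∃ C : ℝ, 0 < C ∧ C₂ ≤ C ∧ ∀ R ε T : ℝ, 1 ≤ R → 0 < ε →
      C * R * (ε ^ 8)⁻¹ * (1 + Real.log (1 + R) + Real.log (1 + 1 / ε)) ^ k ≤ T → 0 ≤ Real.log T →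
      C₁ * (R * (ε ^ 8)⁻¹) * (1 + Real.log T) ^ k ≤ T := by
  obtain ⟨y₀, hy₀⟩ : ∃ y₀ : ℝ, ∀ y ≥ y₀, C₁ * Real.exp 1 * y ^ k ≤ Real.exp (1 / 2 * y) := by
    have h := (isLittleO_pow_exp_pos_mul_atTop k (b := 1 / 2) (by norm_num)).def
      (c := (C₁ * Real.exp 1 + 1)⁻¹) (by positivity)
    obtain ⟨y₀, hy₀⟩ := Filter.eventually_atTop.1 h
    refine ⟨max y₀ 0, fun y hy => ?_⟩
    have h1 := hy₀ y ((le_max_left _ _).trans hy)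
    have hy0 : 0 ≤ y := (le_max_right _ _).trans hy
    rw [Real.norm_of_nonneg (by positivity), Real.norm_of_nonneg (by positivity),
      inv_mul_eq_div, le_div_iff₀ (by positivity)] at h1
    have : 0 ≤ y ^ k := by positivity
    linarith
  -- The value 16 is twice the exponent 8 of `ε`: when `y > m * L`, it gives `log Q ≤ 8 * L ≤ y /
  -- 2`.
  set m := max y₀ 16 with hm
  have hm16 : 16 ≤ m := le_max_right _ _
  have hmk : 0 ≤ m ^ k := by positivity
  refine ⟨max (C₁ * m ^ k) C₂ ⊔ 1, by positivity, (le_max_right _ _).trans (le_max_left _ _), ?_⟩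
  intro R ε T hR hε hT hlogT
  set C := max (C₁ * m ^ k) C₂ ⊔ 1 with hC
  have hC1 : C₁ * m ^ k ≤ C := (le_max_left _ _).trans (le_max_left _ _)
  have hC0 : 0 < C := lt_of_lt_of_le one_pos (le_max_right _ _)
  have hlR : 0 ≤ Real.log (1 + R) := Real.log_nonneg (by linarith)
  have hε' : 0 < 1 / ε := by positivity
  have hlε : 0 ≤ Real.log (1 + 1 / ε) := Real.log_nonneg (by linarith)
  set L := 1 + Real.log (1 + R) + Real.log (1 + 1 / ε) with hL
  have hL1 : 1 ≤ L := by linarith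
  set Q := R * (ε ^ 8)⁻¹ with hQ
  have hQ0 : 0 < Q := by positivity
  rw [mul_assoc C R] at hT
  have hT0 : 0 < T := lt_of_lt_of_le (by positivity) hT
  set y := 1 + Real.log T with hy
  have hy0 : 0 ≤ y := by linarith
  -- Either `log T` is controlled by `L` and the hypothesis on `T` suffices, or `T` is so large that
  -- `Q` and the power of `y` are each, up to constants, at most the square root of `T`.
  rcases le_or_gt y (m * L) with hle | hgt
  · calc C₁ * Q * y ^ k ≤ C₁ * Q * (m * L) ^ k := by gcongr
      _ = C₁ * m ^ k * Q * L ^ k := by rw [mul_pow]; ring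
      _ ≤ C * Q * L ^ k := by gcongr
      _ ≤ T := hT
  · have hym : m ≤ y := by nlinarith
    have h1 := hy₀ y ((le_max_left _ _).trans hym)
    have hlogQ : Real.log Q ≤ 1 / 2 * y := by
      have e1 : Real.log Q = Real.log R + 8 * Real.log (1 / ε) := by
        rw [hQ, Real.log_mul (by positivity) (by positivity), Real.log_inv, Real.log_pow,
          one_div, Real.log_inv]
        push_cast
        ring
      have e2 : Real.log R ≤ Real.log (1 + R) := Real.log_le_log (by positivity) (by linarith)
      have e3 : Real.log (1 / ε) ≤ Real.log (1 + 1 / ε) := Real.log_le_log hε' (by linarith)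
      nlinarith
    have hQe : Q ≤ Real.exp (1 / 2 * y) := (Real.log_le_iff_le_exp hQ0).1 hlogQ
    have hTe : T * Real.exp 1 = Real.exp (1 / 2 * y) * Real.exp (1 / 2 * y) := by
      rw [← Real.exp_add, show 1 / 2 * y + 1 / 2 * y = Real.log T + 1 by rw [hy]; ring,
        Real.exp_add, Real.exp_log hT0]
    have h2 : C₁ * Real.exp 1 * y ^ k * Q ≤ Real.exp (1 / 2 * y) * Real.exp (1 / 2 * y) :=
      mul_le_mul h1 hQe hQ0.le (Real.exp_pos _).le
    refine le_of_mul_le_mul_right ?_ (Real.exp_pos 1)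
    rw [hTe]
    linarith

/-! ### The trivial range of large tolerances -/

section LargeTolerance

variable {d : ℕ} {Θ : Type*} {η : Θ → Act d → ℝ} {ζg ζh ζ₃ : ℝ}

/-- For large `ε` every point is an approximate local maximum. -/
lemma RegularReward.isApproxLocalMax_of_large (h : RegularReward η ζg ζh ζ₃) (hζ₃ : 0 < ζ₃)
    (θ : Θ) (a : Act d) {ε : ℝ} (h1 : ζg ≤ ε)
    (h2 : ζh ^ 2 / (36 * ζ₃) ≤ ε) : IsApproxLocalMax (η θ) ε (6 * √(ζ₃ * ε)) a := by
  refine ⟨(h.norm_gradient_le θ a).trans h1, fun lam hlam => ?_⟩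
  obtain ⟨v, hv⟩ := hlam.exists_hasEigenvector
  have hHv : hess (η θ) a v = lam • v := hv.apply_eq_smul
  have hv0 : 0 < ‖v‖ := norm_pos_iff.2 hv.2
  have h3 : |lam| * ‖v‖ ≤ ζh * ‖v‖ := by
    rw [← Real.norm_eq_abs, ← norm_smul, ← hHv]
    exact (ContinuousLinearMap.le_opNorm _ _).trans
      (mul_le_mul_of_nonneg_right (h.norm_hess_le θ a) hv0.le)
  have h4 : lam ≤ ζh := (le_abs_self _).trans (le_of_mul_le_mul_right h3 hv0)
  have h5 : ζh / 6 ≤ √(ζ₃ * ε) := by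
    refine Real.le_sqrt_of_sq_le ?_
    rw [div_le_iff₀ (by positivity)] at h2
    linarith
  linarith

end LargeTolerance

end ViOlin

end

/-! ### Choice of constants and conclusion -/

theorem mainTheorem3 (ζg ζh ζ₃ : ℝ) (hζg : 0 < ζg) (hζh : 0 < ζh) (hζ₃ : 0 < ζ₃)
    (C₀ : ℝ) (hC₀ : 0 ≤ C₀) (k₀ : ℕ) :
    ∃ C : ℝ, 0 < C ∧ ∃ k : ℕ,
      ∀ (d : ℕ) (Θ : Type*) [MeasurableSpace Θ] (η : Θ → ViOlin.Act d → ℝ) (θstar : Θ),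
        ViOlin.RegularReward η ζg ζh ζ₃ →
        (∀ a, Measurable fun θ => η θ a) →
        ∀ (T : ℕ) (R : ℝ), 1 ≤ R →
          ViOlin.seqRademacher (ViOlin.noise d) ViOlin.labelSet (ViOlin.banditLoss ζg ζh η) T
            ≤ √(R * T * (C₀ * (1 + Real.log T) ^ k₀)) →
        ∀ A : ViOlin.BanditLearner d Θ, (∀ s, IsMarkovKernel (A s)) →
          ViOlin.HasRademacherRegret (ViOlin.noise d) ViOlin.labelSet
            (ViOlin.banditLoss ζg ζh η) A T →
        ∀ (a₀ : ViOlin.Act d) (sel : ViOlin.ActionRule d),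
          ViOlin.IsGreedyRule η θstar a₀ A T sel →
        ∀ ε : ℝ, 0 < ε →
          C * R * (ε ^ 8)⁻¹ * (1 + Real.log (1 + R) + Real.log (1 + 1 / ε)) ^ k ≤ T →
          ∃ (t : ℕ) (ht : t ≤ T), 1 ≤ t ∧
            1 / 2 ≤ ViOlin.actionProb η θstar a₀ sel ht
              (ViOlin.IsApproxLocalMax (η θstar) ε (6 * √(ζ₃ * ε))) := by
  -- For tolerances from `ε₀` on, every point is an approximate local maximum. Below `ε₀`, the
  -- number `S` bounds all step lengths, so that `S` and `c` do not depend on `ε`.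
  set ε₀ := ζg + ζh ^ 2 / (36 * ζ₃) with hε₀
  have hε₀pos : 0 < ε₀ := by positivity
  set S := 1 + ε₀ / ζh + √(ε₀ / ζ₃) + ε₀ / ζ₃ with hS
  have p1 : 0 < ε₀ / ζh := by positivity
  have p2 : 0 ≤ √(ε₀ / ζ₃) := by positivity
  have p3 : 0 < ε₀ / ζ₃ := by positivity
  have hS1 : 1 ≤ S := by linarith
  set c := min (1 / (2 * ζh)) (1 / (ζ₃ * S)) with hc
  have hc0 : 0 < c := lt_min (by positivity) (by positivity)
  have hc2 : c * (ζ₃ * S) ≤ 1 := by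
    rw [← le_div_iff₀ (by positivity)]
    exact min_le_right _ _
  set K := 4 * S ^ 2 / ViOlin.truncMoment ^ 2 with hK
  have hm0 := ViOlin.truncMoment_pos
  have hK0 : 0 < K := by positivity
  -- The first constant is what squaring the bound `hX` on the complexity requires; the second gives
  -- the linear bound `hlin`. The exponent `k₀` is kept as `k`.
  obtain ⟨C, hC, hCge, hnum⟩ := ViOlin.exists_const_mul_log_pow_le (256 * K ^ 2 * C₀ / c ^ 4)
    (8 * ε₀ ^ 6 / c + 4 * ε₀ ^ 8 + 1) (by positivity) k₀
  refine ⟨C, hC, k₀, ?_⟩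
  intro d Θ _ η θstar h hm T R hR hRad A hA hreg a₀ sel hsel ε hε hT
  have hlR : 0 ≤ Real.log (1 + R) := Real.log_nonneg (by linarith)
  have hlε : 0 ≤ Real.log (1 + 1 / ε) := by
    have : 0 < 1 / ε := by positivity
    exact Real.log_nonneg (by linarith)
  have hL1 : 1 ≤ 1 + Real.log (1 + R) + Real.log (1 + 1 / ε) := by linarith
  have hTC : C * (ε ^ 8)⁻¹ ≤ T := by
    refine le_trans ?_ hT
    have h1 := one_le_pow₀ hL1 (n := k₀)
    calc C * (ε ^ 8)⁻¹ ≤ C * R * (ε ^ 8)⁻¹ := by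
          refine mul_le_mul_of_nonneg_right ?_ (by positivity)
          exact le_mul_of_one_le_right hC.le hR
      _ ≤ _ := le_mul_of_one_le_right (by positivity) h1
  have hT0 : (0 : ℝ) < T := lt_of_lt_of_le (by positivity) hTC
  have hT1 : 1 ≤ T := by exact_mod_cast hT0
  rcases le_or_gt ε₀ ε with hbig | hsmall
  · have p4 : 0 < ζh ^ 2 / (36 * ζ₃) := by positivity
    refine ⟨1, hT1, le_rfl, ?_⟩
    have : {ξ : Fin T → ViOlin.Act d × ViOlin.Act d |
        ViOlin.IsApproxLocalMax (η θstar) ε (6 * √(ζ₃ * ε))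
          (ViOlin.violin η θstar a₀ sel 1 (ViOlin.prefixOf hT1 ξ)).1} = Set.univ :=
      Set.eq_univ_of_forall fun ξ => h.isApproxLocalMax_of_large hζ₃ θstar _
        (by linarith) (by linarith)
    rw [ViOlin.actionProb, this, probReal_univ]
    norm_num
  · by_contra hcon
    push Not at hcon
    have hmain := ViOlin.rounds_le_of_actionProb_lt h hm hζh hζ₃ θstar a₀ A hA hreg hsel hε hS1
      (by have : ε / ζh ≤ ε₀ / ζh := by gcongr
          linarith)
      (by have : √(ε / ζ₃) ≤ √(ε₀ / ζ₃) := by gcongr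
          linarith)
      (by have : ε / ζ₃ ≤ ε₀ / ζ₃ := by gcongr
          linarith) hc0 (min_le_left _ _) hc2
      (fun t ht ht1 => hcon t ht ht1)
    have hlogT : 0 ≤ Real.log T := Real.log_nonneg (by exact_mod_cast hT1)
    have hn := hnum R ε T hR hε hT hlogT
    set ω := c * ε ^ 2 with hω
    have hω0 : 0 < ω := by positivity
    have hX : 16 * K * √(R * T * (C₀ * (1 + Real.log T) ^ k₀)) ≤ ω ^ 2 * T := by
      have h1 : √(R * T * (C₀ * (1 + Real.log T) ^ k₀)) ≤ ω ^ 2 * T / (16 * K) := by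
        refine Real.sqrt_le_iff.2 ⟨by positivity, ?_⟩
        calc R * T * (C₀ * (1 + Real.log T) ^ k₀)
            = (256 * K ^ 2 * C₀ / c ^ 4 * (R * (ε ^ 8)⁻¹) * (1 + Real.log T) ^ k₀) *
                (T * (c ^ 4 * ε ^ 8 / (256 * K ^ 2))) := by field_simp
          _ ≤ T * (T * (c ^ 4 * ε ^ 8 / (256 * K ^ 2))) :=
              mul_le_mul_of_nonneg_right hn (by positivity)
          _ = (ω ^ 2 * T / (16 * K)) ^ 2 := by rw [hω]; field_simp; ring
      rw [le_div_iff₀ (by positivity)] at h1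
      linarith
    -- This contradicts `hmain`: with at most `ω * T / 8` spent on the complexity, the balance `ω *
    -- (T - 1) / 2 - ω * T / 4 - ω * T / 8 ≤ 1` would give `ω * T ≤ 8 + 4 * ω`.
    have hlin : 8 + 4 * ω < ω * T := by
      have h1 : (8 * ε₀ ^ 6 / c + 4 * ε₀ ^ 8 + 1) * (ε ^ 8)⁻¹ ≤ T :=
        le_trans (mul_le_mul_of_nonneg_right hCge (by positivity)) hTC
      have h2 : (8 * ε ^ 6 / c + 4 * ε ^ 8) < T * ε ^ 8 := by
        rw [← div_eq_mul_inv, div_le_iff₀ (by positivity)] at h1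
        have h3 : 8 * ε ^ 6 / c ≤ 8 * ε₀ ^ 6 / c := by gcongr
        have h4 : 4 * ε ^ 8 ≤ 4 * ε₀ ^ 8 := by gcongr
        linarith
      have h5 : (8 + 4 * ω) * ε ^ 6 < ω * T * ε ^ 6 := by
        calc (8 + 4 * ω) * ε ^ 6 = c * (8 * ε ^ 6 / c + 4 * ε ^ 8) := by
              rw [hω]; field_simp
          _ < c * (T * ε ^ 8) := mul_lt_mul_of_pos_left h2 hc0
          _ = ω * T * ε ^ 6 := by rw [hω]; ring
      exact lt_of_mul_lt_mul_right h5 (by positivity)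
    have hRadω : K / ω * (2 * ViOlin.seqRademacher (ViOlin.noise d) ViOlin.labelSet
        (ViOlin.banditLoss ζg ζh η) T) ≤ ω * T / 8 := by
      calc _ ≤ K / ω * (2 * √(R * T * (C₀ * (1 + Real.log T) ^ k₀))) := by gcongr
        _ = 16 * K * √(R * T * (C₀ * (1 + Real.log T) ^ k₀)) / (8 * ω) := by field_simp; ring
        _ ≤ ω ^ 2 * T / (8 * ω) := by gcongr
        _ = ω * T / 8 := by field_simp
    linarith
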